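/- Let $(M,g)$ be a smooth Lorentzian manifold of dimension $n>3$ and signature $(-,+,\dots,+)$, with Levi-Civita connection $\nabla$. Let $u$ be a smooth unit time-like vector field, $u_ku^k=-1$, that is shear-free, vorticity-free and acceleration-free, i.e. such that for some smooth scalar field $\varphi$ $$\nabla_i u_j=\varphi\,(g_{ij}+u_iu_j).$$ Let $R_{jklm}$ be the Riemann tensor, $R_{km}=g^{jl}R_{jklm}$ the Ricci tensor, $R=g^{km}R_{km}$ the scalar curvature, and let $$C_{jklm}=R_{jklm}-\frac{1}{n-2}\big(g_{jl}R_{km}-g_{jm}R_{kl}+g_{km}R_{jl}-g_{kl}R_{jm}\big)+\frac{R}{(n-1)(n-2)}\big(g_{jl}g_{km}-g_{jm}g_{kl}\big)$$ be the Weyl tensor. Then: (i) if $u_mC_{jkl}{}^m=0$ on $M$, then $\nabla_mC_{jkl}{}^m=0$ on $M$; (ii) if $\nabla_mC_{jkl}{}^m=0$ on $M$, then $u^p\nabla_p\big(u_mC_{jkl}{}^m\big)=-\varphi\,(n-1)\,u_mC_{jkl}{}^m$ on $M$. -/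

import Mathlib

open scoped Manifold ContDiff

-- The manifold structure of a model space is always the one with the identity as its chart.
attribute [local instance 2000] chartedSpaceSelf

noncomputable section

/-! ## Tensor calculus in a coordinate chart

Points of the coordinate domain are vectors `y` of `ℝⁿ`; `G y` is the matrix of the components
`g_ij(y)` of the metric.  Indices run over `Fin n`. -/

namespace CoordTensor

variable {n : ℕ}

/-- The partial derivative `∂_i f` at `y`. -/
def pd (i : Fin n) (f : EuclideanSpace ℝ (Fin n) → ℝ) (y : EuclideanSpace ℝ (Fin n)) : ℝ :=
  fderiv ℝ f y (EuclideanSpace.single i 1)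

/-- The Christoffel symbols
`Γ^k_ij = (1/2) g^kl (∂_i g_jl + ∂_j g_il - ∂_l g_ij)` of the Levi-Civita connection. -/
def christoffel (G : EuclideanSpace ℝ (Fin n) → Matrix (Fin n) (Fin n) ℝ) (k i j : Fin n)
    (y : EuclideanSpace ℝ (Fin n)) : ℝ :=
  (1 / 2) * ∑ l, (G y)⁻¹ k l *
    (pd i (fun z => G z j l) y + pd j (fun z => G z i l) y - pd l (fun z => G z i j) y)

/-- The covariant derivative `∇_p T_j` of a covariant tensor field of rank one. -/
def covDeriv₁ (G : EuclideanSpace ℝ (Fin n) → Matrix (Fin n) (Fin n) ℝ)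
    (T : Fin n → EuclideanSpace ℝ (Fin n) → ℝ) (p j : Fin n)
    (y : EuclideanSpace ℝ (Fin n)) : ℝ :=
  pd p (T j) y - ∑ a, christoffel G a p j y * T a y

/-- The covariant derivative `∇_p T_jkl` of a covariant tensor field of rank three. -/
def covDeriv₃ (G : EuclideanSpace ℝ (Fin n) → Matrix (Fin n) (Fin n) ℝ)
    (T : Fin n → Fin n → Fin n → EuclideanSpace ℝ (Fin n) → ℝ) (p j k l : Fin n)
    (y : EuclideanSpace ℝ (Fin n)) : ℝ :=
  pd p (T j k l) y
    - ∑ a, christoffel G a p j y * T a k l y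
    - ∑ a, christoffel G a p k y * T j a l y
    - ∑ a, christoffel G a p l y * T j k a y

/-- The covariant derivative `∇_p T_jklm` of a covariant tensor field of rank four. -/
def covDeriv₄ (G : EuclideanSpace ℝ (Fin n) → Matrix (Fin n) (Fin n) ℝ)
    (T : Fin n → Fin n → Fin n → Fin n → EuclideanSpace ℝ (Fin n) → ℝ) (p j k l m : Fin n)
    (y : EuclideanSpace ℝ (Fin n)) : ℝ :=
  pd p (T j k l m) y
    - ∑ a, christoffel G a p j y * T a k l m y
    - ∑ a, christoffel G a p k y * T j a l m y
    - ∑ a, christoffel G a p l y * T j k a m y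
    - ∑ a, christoffel G a p m y * T j k l a y

/-- The Riemann tensor
`R^a_bcd = ∂_c Γ^a_db - ∂_d Γ^a_cb + Γ^a_ce Γ^e_db - Γ^a_de Γ^e_cb`. -/
def riemannUp (G : EuclideanSpace ℝ (Fin n) → Matrix (Fin n) (Fin n) ℝ) (a b c d : Fin n)
    (y : EuclideanSpace ℝ (Fin n)) : ℝ :=
  pd c (christoffel G a d b) y - pd d (christoffel G a c b) y
    + ∑ e, (christoffel G a c e y * christoffel G e d b y
      - christoffel G a d e y * christoffel G e c b y)

/-- The Riemann tensor `R_abcd = g_ae R^e_bcd` with all indices lowered. -/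
def riemann (G : EuclideanSpace ℝ (Fin n) → Matrix (Fin n) (Fin n) ℝ) (a b c d : Fin n)
    (y : EuclideanSpace ℝ (Fin n)) : ℝ :=
  ∑ e, G y a e * riemannUp G e b c d y

/-- The Ricci tensor `R_bd = R^a_bad`. -/
def ricci (G : EuclideanSpace ℝ (Fin n) → Matrix (Fin n) (Fin n) ℝ) (b d : Fin n)
    (y : EuclideanSpace ℝ (Fin n)) : ℝ :=
  ∑ a, riemannUp G a b a d y

/-- The scalar curvature `R = g^bd R_bd`. -/
def scalarCurv (G : EuclideanSpace ℝ (Fin n) → Matrix (Fin n) (Fin n) ℝ)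
    (y : EuclideanSpace ℝ (Fin n)) : ℝ :=
  ∑ b, ∑ d, (G y)⁻¹ b d * ricci G b d y

/-- The Weyl tensor `C_jklm`, the totally trace-free part of the Riemann tensor (for `n ≥ 3`). -/
def weyl (G : EuclideanSpace ℝ (Fin n) → Matrix (Fin n) (Fin n) ℝ) (j k l m : Fin n)
    (y : EuclideanSpace ℝ (Fin n)) : ℝ :=
  riemann G j k l m y
    - 1 / ((n : ℝ) - 2) * (G y j l * ricci G k m y - G y j m * ricci G k l y
        + G y k m * ricci G j l y - G y k l * ricci G j m y)
    + scalarCurv G y / (((n : ℝ) - 1) * ((n : ℝ) - 2)) * (G y j l * G y k m - G y j m * G y k l)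

/-- The divergence `∇_m C_jkl^m = g^mp ∇_p C_jklm` of the Weyl tensor. -/
def divWeyl (G : EuclideanSpace ℝ (Fin n) → Matrix (Fin n) (Fin n) ℝ) (j k l : Fin n)
    (y : EuclideanSpace ℝ (Fin n)) : ℝ :=
  ∑ m, ∑ p, (G y)⁻¹ m p * covDeriv₄ G (weyl G) p j k l m y

/-- The covariant components `v_j = g_jk v^k` of a vector field with components `v^k`. -/
def lower (G : EuclideanSpace ℝ (Fin n) → Matrix (Fin n) (Fin n) ℝ)
    (v : Fin n → EuclideanSpace ℝ (Fin n) → ℝ) (j : Fin n) (y : EuclideanSpace ℝ (Fin n)) : ℝ :=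
  ∑ k, G y j k * v k y

/-- The contraction `v_m C_jkl^m = v^m C_jklm` of the Weyl tensor with a vector field. -/
def weylContr (G : EuclideanSpace ℝ (Fin n) → Matrix (Fin n) (Fin n) ℝ)
    (v : Fin n → EuclideanSpace ℝ (Fin n) → ℝ) (j k l : Fin n)
    (y : EuclideanSpace ℝ (Fin n)) : ℝ :=
  ∑ m, v m y * weyl G j k l m y

end CoordTensor

/-! ## Lorentzian manifolds -/

/-- A smooth Lorentzian metric, of signature `(-,+,...,+)`, on a manifold of dimension `n`:
at each point some vector is time-like and the metric is positive definite on its orthogonal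
complement. -/
structure LorentzMetric (n : ℕ) (M : Type*) [TopologicalSpace M]
    [ChartedSpace (EuclideanSpace ℝ (Fin n)) M] [IsManifold (𝓡 n) ∞ M] where
  /-- The scalar product on each tangent space. -/
  val : (x : M) → TangentSpace (𝓡 n) x →L[ℝ] TangentSpace (𝓡 n) x →L[ℝ] ℝ
  symm : ∀ (x : M) (v w : TangentSpace (𝓡 n) x), val x v w = val x w v
  lorentzian : ∀ x : M, ∃ v : TangentSpace (𝓡 n) x, val x v v < 0 ∧
    ∀ w : TangentSpace (𝓡 n) x, val x v w = 0 → w ≠ 0 → 0 < val x w w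
  contMDiff : ContMDiff (𝓡 n)
    ((𝓡 n).prod 𝓘(ℝ, EuclideanSpace ℝ (Fin n) →L[ℝ] EuclideanSpace ℝ (Fin n) →L[ℝ] ℝ)) ∞
    (fun x ↦ Bundle.TotalSpace.mk'
      (EuclideanSpace ℝ (Fin n) →L[ℝ] EuclideanSpace ℝ (Fin n) →L[ℝ] ℝ)
      (E := fun x : M ↦ TangentSpace (𝓡 n) x →L[ℝ] TangentSpace (𝓡 n) x →L[ℝ] ℝ) x (val x))

section Components

variable {n : ℕ} {M : Type*} [TopologicalSpace M]
  [ChartedSpace (EuclideanSpace ℝ (Fin n)) M] [IsManifold (𝓡 n) ∞ M]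

/-- The coordinate vector `∂_i` of the chart `e`, at the point with coordinates `y`. -/
def coordVec (e : OpenPartialHomeomorph M (EuclideanSpace ℝ (Fin n))) (i : Fin n)
    (y : EuclideanSpace ℝ (Fin n)) : TangentSpace (𝓡 n) (e.symm y) :=
  mfderiv (𝓡 n) (𝓡 n) e.symm y (EuclideanSpace.single i (1 : ℝ) : EuclideanSpace ℝ (Fin n))

/-- The components `g_ij = g(∂_i, ∂_j)` of the metric in the chart `e`. -/
def LorentzMetric.comp (g : LorentzMetric n M)
    (e : OpenPartialHomeomorph M (EuclideanSpace ℝ (Fin n))) (y : EuclideanSpace ℝ (Fin n)) :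
    Matrix (Fin n) (Fin n) ℝ :=
  Matrix.of fun i j => g.val (e.symm y) (coordVec e i y) (coordVec e j y)

/-- The contravariant components `u^i` of the vector field `u` in the chart `e`. -/
def vecComp (e : OpenPartialHomeomorph M (EuclideanSpace ℝ (Fin n)))
    (u : (x : M) → TangentSpace (𝓡 n) x) (i : Fin n) (y : EuclideanSpace ℝ (Fin n)) : ℝ :=
  (show EuclideanSpace ℝ (Fin n) from mfderiv (𝓡 n) (𝓡 n) e (e.symm y) (u (e.symm y))) i

end Components

end

/-! In a chart both assertions are tensor identities between smooth functions. They are proved over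
any commutative `ℝ`-algebra with commuting derivations, where no differentiability needs tracking,
and then read off for the algebra of smooth functions on the chart target.

Write h_ij = g_ij + v_i v_j, X_jkl = v^m C_jklm, E_kl = v^j v^m C_jklm and D_jkl = ∇^m C_jklm. The
Ricci identity for ∇v = φh gives v^m R_jklm = t_j h_kl - t_k h_jl with t = dφ - φ² v (`con_riem`).
Removing the traces shows that X is determined by E: X_jkl = v_k E_jl - v_j E_kl
(`con_wey_eq_elec`).

Part (i), `divWey_eq_zero`. If X = 0, differentiation gives v^m ∇_p C_jklm = -φ C_jklp, so the
contractions of D with v vanish by the symmetries and the tracelessness of C. Also E = 0, which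
forces R_kl = β g_kl + a_k v_l + v_k b_l. By the contracted Bianchi identity (`divWey_eq`), D is
then g_kl s_j - g_jl s_k plus terms carrying a factor v. The vanishing contractions reduce this to
h_kl r_j - h_jl r_k with r orthogonal to v; its trace (n-2) r_j must be zero because D is trace-free
(`eq_zero_of_contractions_eq_zero`).

Part (ii), `nab_con_wey`. If D = 0, the divergence of X on its first index is φE. Computing it again
from X_jkl = v_k E_jl - v_j E_kl yields v^p ∇_p E_kl = -(n-1) φ E_kl + v_k Y_l, where Y is the
divergence of E. Contracting with v^k and using v^k E_kl = 0 gives Y = 0. Since v is geodesic (v^p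
h_pk = 0), the equation for E passes to X. -/

noncomputable section

/-! ## Metrics over a commutative ring with commuting derivations -/

/-- A nondegenerate symmetric matrix `g`, with inverse `gi`, over a commutative `ℝ`-algebra that
carries commuting derivations `d i`: the ring models the smooth functions on a coordinate domain,
and `d i` the partial derivatives. -/
structure DiffMetric (ι A : Type*) [Fintype ι] [DecidableEq ι] [CommRing A] [Algebra ℝ A] where
  /-- The partial derivatives. -/
  d : ι → Derivation ℝ A A
  d_comm : ∀ i j f, d i (d j f) = d j (d i f)
  /-- The components of the metric. -/
  g : ι → ι → A
  /-- The components of the inverse metric. -/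
  gi : ι → ι → A
  symm : ∀ i j, g i j = g j i
  g_mul_gi : Matrix.of g * Matrix.of gi = 1

namespace DiffMetric

open Matrix

set_option linter.unusedSectionVars false

variable {ι A : Type*} [Fintype ι] [DecidableEq ι] [CommRing A] [Algebra ℝ A]
  (S : DiffMetric ι A)

/-- The Christoffel symbols `Γ^k_ij`. -/
def chr (k i j : ι) : A :=
  algebraMap ℝ A (1 / 2) *
    ∑ l, S.gi k l * (S.d i (S.g j l) + S.d j (S.g i l) - S.d l (S.g i j))

/-- The connection matrix `(Γ_p)^a_b = Γ^a_pb`. -/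
def conn (p : ι) : Matrix ι ι A := Matrix.of fun a b => S.chr a p b

/-- The curvature tensor `R^a_bcd`. -/
def rup (a b c d : ι) : A :=
  S.d c (S.chr a d b) - S.d d (S.chr a c b)
    + ∑ e, (S.chr a c e * S.chr e d b - S.chr a d e * S.chr e c b)

/-- The curvature matrices `(F_cd)^a_b = R^a_bcd`. -/
def curv (c d : ι) : Matrix ι ι A := Matrix.of fun a b => S.rup a b c d

/-- The curvature tensor `R_abcd`. -/
def riem (a b c d : ι) : A := ∑ e, S.g a e * S.rup e b c d

/-- The Ricci tensor. -/
def ric (b d : ι) : A := ∑ a, S.rup a b a d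

/-- The trace `g^ij T_ij`. -/
def tr (T : ι → ι → A) : A := ∑ i, ∑ j, S.gi i j * T i j

/-- The scalar curvature. -/
def scal : A := S.tr S.ric

/-- The covariant derivative of a covector field. -/
def nab₁ (T : ι → A) (p j : ι) : A := S.d p (T j) - ∑ a, S.chr a p j * T a

/-- The covariant derivative of a vector field. -/
def nabUp (v : ι → A) (p m : ι) : A := S.d p (v m) + ∑ a, S.chr m p a * v a

/-- The covariant derivative of a covariant tensor field of rank two. -/
def nab₂ (T : ι → ι → A) (p j k : ι) : A :=
  S.d p (T j k) - ∑ a, S.chr a p j * T a k - ∑ a, S.chr a p k * T j a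

/-- The covariant derivative of a covariant tensor field of rank three. -/
def nab₃ (T : ι → ι → ι → A) (p j k l : ι) : A :=
  S.d p (T j k l) - ∑ a, S.chr a p j * T a k l - ∑ a, S.chr a p k * T j a l
    - ∑ a, S.chr a p l * T j k a

/-- The covariant derivative of a covariant tensor field of rank four. -/
def nab₄ (T : ι → ι → ι → ι → A) (p j k l m : ι) : A :=
  S.d p (T j k l m) - ∑ a, S.chr a p j * T a k l m - ∑ a, S.chr a p k * T j a l m
    - ∑ a, S.chr a p l * T j k a m - ∑ a, S.chr a p m * T j k l a

/-- The covariant derivative of the curvature tensor `R^a_bcd`. -/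
def nabRup (p a b c d : ι) : A :=
  S.d p (S.rup a b c d) + ∑ e, S.chr a p e * S.rup e b c d - ∑ e, S.chr e p b * S.rup a e c d
    - ∑ e, S.chr e p c * S.rup a b e d - ∑ e, S.chr e p d * S.rup a b c e

/-! ### The Levi-Civita connection -/

/-- The metric as a matrix. -/
def gMat : Matrix ι ι A := Matrix.of S.g

/-- The inverse metric as a matrix. -/
def giMat : Matrix ι ι A := Matrix.of S.gi

lemma gMat_mul_giMat : S.gMat * S.giMat = 1 := S.g_mul_gi

lemma giMat_mul_gMat : S.giMat * S.gMat = 1 := mul_eq_one_comm.mp S.g_mul_gi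

lemma gMat_transpose : S.gMatᵀ = S.gMat := by ext i j; exact S.symm j i

lemma giMat_transpose : S.giMatᵀ = S.giMat := by
  have h : S.giMatᵀ * S.gMat = 1 := by
    rw [← S.gMat_transpose, ← transpose_mul, S.gMat_mul_giMat, transpose_one]
  calc S.giMatᵀ = S.giMatᵀ * (S.gMat * S.giMat) := by rw [S.gMat_mul_giMat, mul_one]
    _ = S.giMat := by rw [← mul_assoc, h, one_mul]

lemma gi_symm (i j : ι) : S.gi i j = S.gi j i :=
  congrFun (congrFun S.giMat_transpose j) i

lemma sum_gi_g (i k : ι) : ∑ j, S.gi i j * S.g j k = if i = k then 1 else 0 := by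
  have := congrFun (congrFun S.giMat_mul_gMat i) k
  rwa [mul_apply, one_apply] at this

lemma chr_symm (k i j : ι) : S.chr k i j = S.chr k j i := by
  unfold chr
  congr 1
  refine Finset.sum_congr rfl fun l _ => ?_
  rw [S.symm i j]; ring

lemma sum_g_mul_sum_gi (i : ι) (f : ι → A) : ∑ a, S.g i a * ∑ l, S.gi a l * f l = f i := by
  have : S.gMat *ᵥ (S.giMat *ᵥ f) = f := by rw [mulVec_mulVec, S.gMat_mul_giMat, one_mulVec]
  simpa only [mulVec, dotProduct, gMat, giMat, of_apply] using congrFun this i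

lemma sum_gi_mul_sum_g (i : ι) (f : ι → A) : ∑ a, S.gi i a * ∑ l, S.g a l * f l = f i := by
  have : S.giMat *ᵥ (S.gMat *ᵥ f) = f := by rw [mulVec_mulVec, S.giMat_mul_gMat, one_mulVec]
  simpa only [mulVec, dotProduct, gMat, giMat, of_apply] using congrFun this i

lemma half_add_half : algebraMap ℝ A (1 / 2) + algebraMap ℝ A (1 / 2) = 1 := by
  rw [← map_add]; norm_num

lemma sum_g_chr (i p j : ι) : ∑ a, S.g i a * S.chr a p j =
    algebraMap ℝ A (1 / 2) * (S.d p (S.g j i) + S.d j (S.g p i) - S.d i (S.g p j)) := by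
  rw [← S.sum_g_mul_sum_gi i (fun l => S.d p (S.g j l) + S.d j (S.g p l) - S.d l (S.g p j)),
    Finset.mul_sum]
  exact Finset.sum_congr rfl fun a _ => by rw [chr]; ring

/-- The connection is compatible with the metric. -/
lemma d_g (p i j : ι) :
    S.d p (S.g i j) = ∑ a, S.chr a p i * S.g a j + ∑ a, S.chr a p j * S.g i a := by
  have h1 : ∑ a, S.chr a p i * S.g a j = ∑ a, S.g j a * S.chr a p i :=
    Finset.sum_congr rfl fun a _ => by rw [S.symm a j]; ring
  have h2 : ∑ a, S.chr a p j * S.g i a = ∑ a, S.g i a * S.chr a p j :=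
    Finset.sum_congr rfl fun a _ => by ring
  rw [h1, h2, sum_g_chr, sum_g_chr, S.symm j i, S.symm p i, S.symm p j]
  linear_combination (-(S.d p (S.g i j))) * half_add_half (A := A)

lemma map_d_mul (p : ι) (M N : Matrix ι ι A) :
    (M * N).map (S.d p) = M.map (S.d p) * N + M * N.map (S.d p) := by
  ext i j
  simp only [map_apply, mul_apply, map_sum, Derivation.leibniz, smul_eq_mul, Matrix.add_apply,
    ← Finset.sum_add_distrib]
  exact Finset.sum_congr rfl fun _ _ => by ring

lemma map_d_g (p : ι) : S.gMat.map (S.d p) = (S.conn p)ᵀ * S.gMat + S.gMat * S.conn p := by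
  ext i j
  simp only [map_apply, S.d_g, Matrix.add_apply, mul_apply, transpose_apply, conn, of_apply, gMat]
  congr 1
  exact Finset.sum_congr rfl fun _ _ => by ring

/-- Differentiate `giMat * gMat = 1`, insert metric compatibility and multiply by `giMat` on the
right. -/
lemma map_d_gi (p : ι) : S.giMat.map (S.d p) = -(S.giMat * (S.conn p)ᵀ + S.conn p * S.giMat) := by
  have h : (S.giMat * S.gMat).map (S.d p) = 0 := by
    rw [S.giMat_mul_gMat]
    ext i j
    by_cases hij : i = j <;> simp [one_apply, hij]
  rw [map_d_mul, map_d_g] at h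
  have h2 := congrArg (· * S.giMat) h
  simp only [add_mul, mul_add, mul_assoc, S.gMat_mul_giMat, mul_one, zero_mul] at h2
  rw [← mul_assoc S.giMat S.gMat, S.giMat_mul_gMat, one_mul] at h2
  rw [eq_neg_iff_add_eq_zero, ← h2]

lemma d_gi (p i j : ι) :
    S.d p (S.gi i j) = -(∑ a, S.chr i p a * S.gi a j + ∑ a, S.chr j p a * S.gi i a) := by
  have := congrFun (congrFun (S.map_d_gi p) i) j
  simp only [map_apply, Matrix.add_apply, mul_apply, transpose_apply, conn, of_apply,
    Matrix.neg_apply, giMat] at this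
  rw [this, add_comm]
  congr 2
  exact Finset.sum_congr rfl fun _ _ => by ring

/-! ### Symmetries of the curvature -/

lemma curv_eq (c d : ι) : S.curv c d = (S.conn d).map (S.d c) - (S.conn c).map (S.d d)
    + (S.conn c * S.conn d - S.conn d * S.conn c) := by
  ext a b
  simp [curv, conn, rup, mul_apply, Finset.sum_sub_distrib]

lemma rup_antisymm (a b c d : ι) : S.rup a b c d = -S.rup a b d c := by
  simp only [rup, Finset.sum_sub_distrib]; ring

lemma riem_eq (a b c d : ι) : S.riem a b c d = (S.gMat * S.curv c d) a b := by
  simp [riem, mul_apply, curv, gMat]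

lemma riem_antisymm_right (a b c d : ι) : S.riem a b c d = -S.riem a b d c := by
  simp only [riem, ← Finset.sum_neg_distrib]
  exact Finset.sum_congr rfl fun e _ => by rw [rup_antisymm]; ring

lemma map_d_map_d_comm (c d : ι) (M : Matrix ι ι A) :
    (M.map (S.d c)).map (S.d d) = (M.map (S.d d)).map (S.d c) := by
  ext i j; simp [S.d_comm d c]

/-- Integrability condition of ∂g = Γᵀg + gΓ: differentiating once more and equating the mixed
second derivatives leaves exactly the curvature terms. -/
lemma curv_antisymm_aux (c d : ι) : (S.curv c d)ᵀ * S.gMat + S.gMat * S.curv c d = 0 := by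
  have h := S.map_d_map_d_comm d c S.gMat
  have hadd : ∀ (p : ι) (M N : Matrix ι ι A),
      (M + N).map (S.d p) = M.map (S.d p) + N.map (S.d p) := by
    intro p M N; ext; simp
  rw [map_d_g, map_d_g, hadd, hadd, map_d_mul, map_d_mul, map_d_mul, map_d_mul, map_d_g,
    map_d_g, ← sub_eq_zero] at h
  rw [← h, curv_eq]
  simp only [transpose_add, transpose_sub, transpose_mul, transpose_map]
  noncomm_ring

lemma riem_antisymm_left (a b c d : ι) : S.riem a b c d = -S.riem b a c d := by
  have h := congrFun (congrFun (S.curv_antisymm_aux c d) a) b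
  rw [← S.gMat_transpose, ← transpose_mul, S.gMat_transpose] at h
  simp only [Matrix.add_apply, transpose_apply, Matrix.zero_apply, ← riem_eq] at h
  linear_combination h

lemma rup_bianchi (a b c d : ι) : S.rup a b c d + S.rup a c d b + S.rup a d b c = 0 := by
  simp only [rup, Finset.sum_sub_distrib]
  rw [S.chr_symm a d b, S.chr_symm a c b, S.chr_symm a d c]
  simp only [S.chr_symm _ d b, S.chr_symm _ c b, S.chr_symm _ d c]
  ring

lemma riem_bianchi (a b c d : ι) : S.riem a b c d + S.riem a c d b + S.riem a d b c = 0 := by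
  simp only [riem, ← Finset.sum_add_distrib, ← mul_add, rup_bianchi, mul_zero,
    Finset.sum_const_zero]

/-- The ring need not be a domain; this is what allows x = -x to give x = 0. -/
lemma isUnit_two : IsUnit (2 : A) := by
  have h : (2 : A) = algebraMap ℝ A 2 := (map_ofNat _ 2).symm
  rw [h]; exact (IsUnit.mk0 (2 : ℝ) two_ne_zero).map _

/-- The usual octahedron argument: an alternating sum of four first Bianchi identities, rewritten
with the two antisymmetries, leaves twice the difference of the two sides. -/
lemma riem_pair_symm (a b c d : ι) : S.riem a b c d = S.riem c d a b := by
  have h1 := S.riem_bianchi a b c d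
  have h2 := S.riem_bianchi b c d a
  have h3 := S.riem_bianchi c d a b
  have h4 := S.riem_bianchi d a b c
  rw [S.riem_antisymm_right b c d a, S.riem_antisymm_left b d a c,
    S.riem_antisymm_left b a c d] at h2
  rw [S.riem_antisymm_left c a b d, S.riem_antisymm_right a c b d, S.riem_antisymm_left c b d a,
    S.riem_antisymm_right b c d a] at h3
  rw [S.riem_antisymm_left d a b c, S.riem_antisymm_right d b c a,
    S.riem_antisymm_left d c a b] at h4
  refine isUnit_two.mul_left_cancel ?_
  linear_combination h1 - h2 - h3 + h4

/-! ### The second Bianchi identity -/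

lemma nabRup_eq (p a b c d : ι) : S.nabRup p a b c d =
    ((S.curv c d).map (S.d p) + S.conn p * S.curv c d - S.curv c d * S.conn p) a b
    - ∑ e, S.chr e p c * S.rup a b e d - ∑ e, S.chr e p d * S.rup a b c e := by
  simp only [nabRup, Matrix.add_apply, Matrix.sub_apply, map_apply, mul_apply, curv, conn,
    of_apply, mul_comm (S.rup a _ c d)]

/-- With F_cd = ∂_c Γ_d - ∂_d Γ_c + [Γ_c, Γ_d], the second derivatives cancel because the ∂ commute,
and the cubic terms cancel by the Jacobi identity. The indices c, d are not yet differentiated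
covariantly. -/
lemma curv_bianchi (p c d : ι) :
    ((S.curv c d).map (S.d p) + S.conn p * S.curv c d - S.curv c d * S.conn p) +
    ((S.curv d p).map (S.d c) + S.conn c * S.curv d p - S.curv d p * S.conn c) +
    ((S.curv p c).map (S.d d) + S.conn d * S.curv p c - S.curv p c * S.conn d) = 0 := by
  have hadd : ∀ (p : ι) (M N : Matrix ι ι A),
      (M + N).map (S.d p) = M.map (S.d p) + N.map (S.d p) := by
    intro p M N; ext; simp
  have hsub : ∀ (p : ι) (M N : Matrix ι ι A),
      (M - N).map (S.d p) = M.map (S.d p) - N.map (S.d p) := by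
    intro p M N; ext; simp
  simp only [curv_eq, hadd, hsub, map_d_mul]
  rw [S.map_d_map_d_comm c p, S.map_d_map_d_comm d p, S.map_d_map_d_comm d c]
  noncomm_ring

/-- The Christoffel terms acting on the form indices, absent from `curv_bianchi`, cancel in the
cyclic sum because the connection is torsion-free and F is antisymmetric. -/
lemma nabRup_bianchi (p a b c d : ι) :
    S.nabRup p a b c d + S.nabRup c a b d p + S.nabRup d a b p c = 0 := by
  have h := congrFun (congrFun (S.curv_bianchi p c d) a) b
  rw [Matrix.add_apply, Matrix.add_apply, Matrix.zero_apply] at h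
  have swap : ∀ x y z : ι, ∑ e, S.chr e x y * S.rup a b z e = -∑ e, S.chr e y x * S.rup a b e z := by
    intro x y z
    rw [← Finset.sum_neg_distrib]
    exact Finset.sum_congr rfl fun e _ => by rw [S.rup_antisymm a b z e, S.chr_symm e x y]; ring
  rw [nabRup_eq, nabRup_eq, nabRup_eq, swap p d c, swap c p d, swap d c p]
  linear_combination h

/-- Lowering an index commutes with ∇ since ∇g = 0. -/
lemma nab_riem (p a b c d : ι) :
    S.nab₄ S.riem p a b c d = ∑ e, S.g a e * S.nabRup p e b c d := by
  have h1 : S.d p (S.riem a b c d) = ∑ e, S.g a e * S.d p (S.rup e b c d)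
      + ∑ f, S.chr f p a * S.riem f b c d
      + ∑ e, S.g a e * ∑ f, S.chr e p f * S.rup f b c d := by
    have e1 : ∑ f, S.chr f p a * S.riem f b c d
        = ∑ e, S.rup e b c d * ∑ f, S.chr f p a * S.g f e := by
      simp only [riem, Finset.mul_sum]
      rw [Finset.sum_comm]
      exact Finset.sum_congr rfl fun _ _ => Finset.sum_congr rfl fun _ _ => by ring
    have e2 : ∑ e, S.g a e * ∑ f, S.chr e p f * S.rup f b c d
        = ∑ e, S.rup e b c d * ∑ f, S.chr f p e * S.g a f := by
      simp only [Finset.mul_sum]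
      rw [Finset.sum_comm]
      exact Finset.sum_congr rfl fun _ _ => Finset.sum_congr rfl fun _ _ => by ring
    rw [e1, e2, ← Finset.sum_add_distrib, ← Finset.sum_add_distrib, riem, map_sum]
    refine Finset.sum_congr rfl fun e _ => ?_
    rw [Derivation.leibniz, smul_eq_mul, smul_eq_mul, S.d_g]
    ring
  have pull : ∀ (f : ι → A) (R : ι → ι → A),
      ∑ x, f x * ∑ e, S.g a e * R e x = ∑ e, S.g a e * ∑ x, f x * R e x := by
    intro f R
    simp only [Finset.mul_sum]
    rw [Finset.sum_comm]
    exact Finset.sum_congr rfl fun _ _ => Finset.sum_congr rfl fun _ _ => by ring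
  have hb := pull (fun x => S.chr x p b) (fun e x => S.rup e x c d)
  have hc := pull (fun x => S.chr x p c) (fun e x => S.rup e b x d)
  have hd := pull (fun x => S.chr x p d) (fun e x => S.rup e b c x)
  simp only [nab₄, nabRup, mul_add, mul_sub, Finset.sum_add_distrib, Finset.sum_sub_distrib]
  rw [h1, ← hb, ← hc, ← hd]
  simp only [riem]
  ring

lemma nab_ric (p b d : ι) : S.nab₂ S.ric p b d = ∑ a, S.nabRup p a b a d := by
  have pull : ∀ (f : ι → A) (R : ι → ι → A),
      ∑ x, f x * ∑ a, R a x = ∑ a, ∑ x, f x * R a x := by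
    intro f R
    simp only [Finset.mul_sum]
    rw [Finset.sum_comm]
  have hb := pull (fun x => S.chr x p b) (fun a x => S.rup a x a d)
  have hd := pull (fun x => S.chr x p d) (fun a x => S.rup a b a x)
  have hc : ∑ a, ∑ e, S.chr a p e * S.rup e b a d = ∑ a, ∑ e, S.chr e p a * S.rup a b e d :=
    Finset.sum_comm
  simp only [nab₂, nabRup, Finset.sum_add_distrib, Finset.sum_sub_distrib]
  rw [← hb, ← hd, hc]
  simp only [ric, map_sum]
  ring

/-! ### Contractions -/

/-- The contraction `v^i f_i`. -/
def con (v f : ι → A) : A := ∑ i, v i * f i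

/-- The covariant components of a vector field. -/
def low (v : ι → A) (j : ι) : A := ∑ k, S.g j k * v k

lemma con_add (v f h : ι → A) : con v (fun i => f i + h i) = con v f + con v h := by
  simp [con, mul_add, Finset.sum_add_distrib]

lemma con_sub (v f h : ι → A) : con v (fun i => f i - h i) = con v f - con v h := by
  simp [con, mul_sub, Finset.sum_sub_distrib]

lemma con_neg (v f : ι → A) : con v (fun i => -f i) = -con v f := by
  simp [con]

lemma con_zero (v : ι → A) : con v (fun _ => 0) = 0 := by simp [con]

lemma con_const_mul (v : ι → A) (c : A) (f : ι → A) :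
    con v (fun i => c * f i) = c * con v f := by
  rw [con, con, Finset.mul_sum]; exact Finset.sum_congr rfl fun _ _ => by ring

lemma con_mul_const (v f : ι → A) (c : A) : con v (fun i => f i * c) = con v f * c := by
  rw [con, con, Finset.sum_mul]; exact Finset.sum_congr rfl fun _ _ => by ring

lemma con_g_left (v : ι → A) (k : ι) : con v (fun i => S.g i k) = S.low v k :=
  Finset.sum_congr rfl fun i _ => by simp only [S.symm i k, mul_comm]

lemma con_g_right (v : ι → A) (k : ι) : con v (fun i => S.g k i) = S.low v k :=
  Finset.sum_congr rfl fun i _ => by ring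

lemma tr_add (T U : ι → ι → A) : S.tr (fun i j => T i j + U i j) = S.tr T + S.tr U := by
  simp [tr, mul_add, Finset.sum_add_distrib]

lemma tr_sub (T U : ι → ι → A) : S.tr (fun i j => T i j - U i j) = S.tr T - S.tr U := by
  simp [tr, mul_sub, Finset.sum_sub_distrib]

lemma tr_neg (T : ι → ι → A) : S.tr (fun i j => -T i j) = -S.tr T := by
  simp [tr]

lemma tr_zero : S.tr (fun _ _ => 0) = 0 := by simp [tr]

lemma tr_const_mul (c : A) (T : ι → ι → A) : S.tr (fun i j => c * T i j) = c * S.tr T := by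
  simp only [tr, Finset.mul_sum]
  exact Finset.sum_congr rfl fun _ _ => Finset.sum_congr rfl fun _ _ => by ring

lemma tr_mul_const (T : ι → ι → A) (c : A) : S.tr (fun i j => T i j * c) = S.tr T * c := by
  rw [mul_comm, ← tr_const_mul]; simp only [mul_comm]

lemma tr_swap (T : ι → ι → A) : S.tr (fun i j => T j i) = S.tr T := by
  rw [tr, tr, Finset.sum_comm]
  exact Finset.sum_congr rfl fun _ _ => Finset.sum_congr rfl fun _ _ => by rw [S.gi_symm]

lemma tr_g : S.tr (fun i j => S.g i j) = Fintype.card ι := by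
  have : ∀ i, ∑ j, S.gi i j * S.g i j = 1 := fun i => by
    simpa only [S.symm i, if_true] using S.sum_gi_g i i
  simp [tr, this]

lemma tr_g_mul (k : ι) (f : ι → A) : S.tr (fun i j => S.g k i * f j) = f k := by
  rw [tr, ← S.sum_g_mul_sum_gi k f]
  refine Finset.sum_congr rfl fun i _ => ?_
  rw [Finset.mul_sum]
  exact Finset.sum_congr rfl fun _ _ => by ring

lemma tr_g_mul' (k : ι) (f : ι → A) : S.tr (fun i j => S.g i k * f j) = f k := by
  simp only [S.symm _ k, tr_g_mul]

lemma tr_g_mul_swap (k : ι) (f : ι → A) : S.tr (fun i j => S.g k j * f i) = f k := by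
  rw [S.tr_swap (fun i j => S.g k i * f j), tr_g_mul]

lemma tr_g_mul_swap' (k : ι) (f : ι → A) : S.tr (fun i j => S.g j k * f i) = f k := by
  simp only [S.symm _ k, tr_g_mul_swap]

lemma tr_low_mul (v f : ι → A) : S.tr (fun i j => S.low v i * f j) = con v f := by
  have : ∀ j, ∑ i, S.gi j i * S.low v i = v j := fun j => S.sum_gi_mul_sum_g j v
  rw [tr, Finset.sum_comm, con]
  refine Finset.sum_congr rfl fun j _ => ?_
  rw [← this j, Finset.sum_mul]
  exact Finset.sum_congr rfl fun _ _ => by rw [S.gi_symm]; ring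

lemma tr_low_mul_swap (v f : ι → A) : S.tr (fun i j => S.low v j * f i) = con v f := by
  rw [S.tr_swap (fun i j => S.low v i * f j), tr_low_mul]

lemma tr_con (v : ι → A) (T : ι → ι → ι → A) :
    S.tr (fun i j => con v (T i j)) = con v (fun m => S.tr (fun i j => T i j m)) := by
  simp only [tr, con, Finset.mul_sum]
  rw [Finset.sum_comm' (t' := Finset.univ) (s' := fun _ => Finset.univ) (by simp)]
  conv_rhs => rw [Finset.sum_comm]
  rw [Finset.sum_comm]
  refine Finset.sum_congr rfl fun _ _ => ?_
  rw [Finset.sum_comm]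
  exact Finset.sum_congr rfl fun _ _ => Finset.sum_congr rfl fun _ _ => by ring

lemma con_con (v x : ι → A) (T : ι → ι → A) :
    con v (fun i => con x (T i)) = con x (fun j => con v (fun i => T i j)) := by
  simp only [con, Finset.mul_sum]
  rw [Finset.sum_comm]
  exact Finset.sum_congr rfl fun _ _ => Finset.sum_congr rfl fun _ _ => by ring

lemma tr_eq_zero_of_antisymm {T : ι → ι → A} (h : ∀ i j, T i j = -T j i) : S.tr T = 0 := by
  have h1 : S.tr T = -S.tr T := by
    conv_lhs => rw [show T = fun i j => -T j i from funext fun i => funext fun j => h i j]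
    rw [tr_neg, tr_swap]
  refine isUnit_two.mul_left_cancel ?_
  linear_combination h1

/-! ### Ricci and Weyl tensors -/

lemma tr_riem (b d : ι) : S.tr (fun a c => S.riem a b c d) = S.ric b d := by
  have : ∀ c, ∑ a, S.gi c a * S.riem a b c d = S.rup c b c d := fun c =>
    S.sum_gi_mul_sum_g c (fun e => S.rup e b c d)
  rw [tr, Finset.sum_comm, ric]
  refine Finset.sum_congr rfl fun c _ => ?_
  rw [← this c]
  exact Finset.sum_congr rfl fun _ _ => by rw [S.gi_symm]

lemma ric_symm (b d : ι) : S.ric b d = S.ric d b := by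
  rw [← tr_riem, ← tr_riem, ← S.tr_swap (fun a c => S.riem a b c d)]
  simp only [S.riem_pair_symm _ d _ b]

/-- The constant `1 / (n - 2)`. -/
def weylCoeff (ι A : Type*) [Fintype ι] [CommRing A] [Algebra ℝ A] : A :=
  algebraMap ℝ A (1 / ((Fintype.card ι : ℝ) - 2))

/-- The constant `1 / ((n - 1) (n - 2))`. -/
def weylCoeff' (ι A : Type*) [Fintype ι] [CommRing A] [Algebra ℝ A] : A :=
  algebraMap ℝ A (1 / (((Fintype.card ι : ℝ) - 1) * ((Fintype.card ι : ℝ) - 2)))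

/-- The Weyl tensor. -/
def wey (j k l m : ι) : A :=
  S.riem j k l m
    - weylCoeff ι A * (S.g j l * S.ric k m - S.g j m * S.ric k l + S.g k m * S.ric j l
        - S.g k l * S.ric j m)
    + weylCoeff' ι A * S.scal * (S.g j l * S.g k m - S.g j m * S.g k l)

/-- The divergence of the Weyl tensor. -/
def divWey (j k l : ι) : A := S.tr (fun m p => S.nab₄ S.wey p j k l m)

/-- Stands in for division by n - 2, which the ring does not provide. -/
lemma weylCoeff_mul (h : 3 ≤ Fintype.card ι) :
    weylCoeff ι A * ((Fintype.card ι : A) - 2) = 1 := by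
  have h3 : (3 : ℝ) ≤ Fintype.card ι := by exact_mod_cast h
  have : (Fintype.card ι : A) - 2 = algebraMap ℝ A ((Fintype.card ι : ℝ) - 2) := by
    simp [map_ofNat (algebraMap ℝ A) 2]
  rw [weylCoeff, this, ← map_mul, one_div_mul_cancel (by linarith), map_one]

lemma weylCoeff'_mul (h : 3 ≤ Fintype.card ι) :
    weylCoeff' ι A * ((Fintype.card ι : A) - 1) = weylCoeff ι A := by
  have h3 : (3 : ℝ) ≤ Fintype.card ι := by exact_mod_cast h
  have : (Fintype.card ι : A) - 1 = algebraMap ℝ A ((Fintype.card ι : ℝ) - 1) := by simp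
  rw [weylCoeff, weylCoeff', this, ← map_mul]
  congr 1
  have h1 : (Fintype.card ι : ℝ) - 1 ≠ 0 := by linarith
  have h2 : (Fintype.card ι : ℝ) - 2 ≠ 0 := by linarith
  field_simp

lemma wey_antisymm_right (j k l m : ι) : S.wey j k l m = -S.wey j k m l := by
  simp only [wey]; rw [S.riem_antisymm_right]; ring

lemma wey_pair_symm (j k l m : ι) : S.wey j k l m = S.wey l m j k := by
  simp only [wey]
  rw [S.riem_pair_symm, S.symm l j, S.symm m k, S.symm l k, S.symm m j, S.ric_symm m k,
    S.ric_symm m j, S.ric_symm l k, S.ric_symm l j]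
  ring

lemma wey_antisymm_left (j k l m : ι) : S.wey j k l m = -S.wey k j l m := by
  rw [wey_pair_symm, wey_antisymm_right, wey_pair_symm]

lemma tr_wey (h : 3 ≤ Fintype.card ι) (k m : ι) : S.tr (fun j l => S.wey j k l m) = 0 := by
  simp only [wey, tr_add, tr_sub, tr_const_mul, tr_mul_const, tr_riem, tr_g, tr_g_mul',
    tr_g_mul_swap]
  have e : S.tr (fun j l => S.ric j l) = S.scal := rfl
  rw [e, S.symm k m]
  linear_combination (-S.ric k m) * weylCoeff_mul (A := A) h +
    S.scal * S.g m k * weylCoeff'_mul (A := A) h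

/-! ### Rules for covariant derivatives -/

lemma nab₂_g (p j k : ι) : S.nab₂ S.g p j k = 0 := by
  rw [nab₂, S.d_g]; ring

lemma nab₂_mul (x y : ι → A) (p j k : ι) :
    S.nab₂ (fun j k => x j * y k) p j k = S.nab₁ x p j * y k + x j * S.nab₁ y p k := by
  have h1 : ∑ a, S.chr a p j * (x a * y k) = (∑ a, S.chr a p j * x a) * y k := by
    rw [Finset.sum_mul]; exact Finset.sum_congr rfl fun _ _ => by ring
  have h2 : ∑ a, S.chr a p k * (x j * y a) = x j * (∑ a, S.chr a p k * y a) := by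
    rw [Finset.mul_sum]; exact Finset.sum_congr rfl fun _ _ => by ring
  simp only [nab₂, nab₁, Derivation.leibniz, smul_eq_mul, h1, h2]
  ring

lemma nab₂_smul (c : A) (T : ι → ι → A) (p j k : ι) :
    S.nab₂ (fun j k => c * T j k) p j k = S.d p c * T j k + c * S.nab₂ T p j k := by
  have h : ∀ f R : ι → A, ∑ a, f a * (c * R a) = c * ∑ a, f a * R a := fun f R => by
    rw [Finset.mul_sum]; exact Finset.sum_congr rfl fun _ _ => by ring
  simp only [nab₂, Derivation.leibniz, smul_eq_mul, h]
  ring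

lemma nab₂_add (T U : ι → ι → A) (p j k : ι) :
    S.nab₂ (fun j k => T j k + U j k) p j k = S.nab₂ T p j k + S.nab₂ U p j k := by
  simp only [nab₂, map_add, mul_add, Finset.sum_add_distrib]; ring

lemma nab₃_mul (x : ι → A) (T : ι → ι → A) (p j k l : ι) :
    S.nab₃ (fun j k l => x k * T j l) p j k l
      = S.nab₁ x p k * T j l + x k * S.nab₂ T p j l := by
  have h1 : ∀ f R : ι → A, ∑ a, f a * (x k * R a) = x k * ∑ a, f a * R a := fun f R => by
    rw [Finset.mul_sum]; exact Finset.sum_congr rfl fun _ _ => by ring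
  have h2 : ∑ a, S.chr a p k * (x a * T j l) = (∑ a, S.chr a p k * x a) * T j l := by
    rw [Finset.sum_mul]; exact Finset.sum_congr rfl fun _ _ => by ring
  simp only [nab₃, nab₂, nab₁, Derivation.leibniz, smul_eq_mul, h1, h2]
  ring

lemma nab₃_swap (T : ι → ι → ι → A) (p j k l : ι) :
    S.nab₃ (fun j k l => T k j l) p j k l = S.nab₃ T p k j l := by
  simp only [nab₃]; ring

lemma nab₃_sub (T U : ι → ι → ι → A) (p j k l : ι) :
    S.nab₃ (fun j k l => T j k l - U j k l) p j k l
      = S.nab₃ T p j k l - S.nab₃ U p j k l := by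
  simp only [nab₃, map_sub, mul_sub, Finset.sum_sub_distrib]; ring

lemma nab₄_mul (T U : ι → ι → A) (p j k l m : ι) :
    S.nab₄ (fun j k l m => T j l * U k m) p j k l m
      = S.nab₂ T p j l * U k m + T j l * S.nab₂ U p k m := by
  have h1 : ∀ f R : ι → A, ∑ a, f a * (T j l * R a) = T j l * ∑ a, f a * R a := fun f R => by
    rw [Finset.mul_sum]; exact Finset.sum_congr rfl fun _ _ => by ring
  have h2 : ∀ f R : ι → A, ∑ a, f a * (R a * U k m) = (∑ a, f a * R a) * U k m := fun f R => by
    rw [Finset.sum_mul]; exact Finset.sum_congr rfl fun _ _ => by ring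
  simp only [nab₄, nab₂, Derivation.leibniz, smul_eq_mul, h1, h2]
  ring

lemma nab₄_swap (T : ι → ι → ι → ι → A) (p j k l m : ι) :
    S.nab₄ (fun j k l m => T j k m l) p j k l m = S.nab₄ T p j k m l := by
  simp only [nab₄]; ring

lemma nab₄_pair_swap (T : ι → ι → ι → ι → A) (p j k l m : ι) :
    S.nab₄ (fun j k l m => T l m j k) p j k l m = S.nab₄ T p l m j k := by
  simp only [nab₄]; ring

lemma nab₄_add (T U : ι → ι → ι → ι → A) (p j k l m : ι) :
    S.nab₄ (fun j k l m => T j k l m + U j k l m) p j k l m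
      = S.nab₄ T p j k l m + S.nab₄ U p j k l m := by
  simp only [nab₄, map_add, mul_add, Finset.sum_add_distrib]; ring

lemma nab₄_sub (T U : ι → ι → ι → ι → A) (p j k l m : ι) :
    S.nab₄ (fun j k l m => T j k l m - U j k l m) p j k l m
      = S.nab₄ T p j k l m - S.nab₄ U p j k l m := by
  simp only [nab₄, map_sub, mul_sub, Finset.sum_sub_distrib]; ring

lemma nab₄_neg (T : ι → ι → ι → ι → A) (p j k l m : ι) :
    S.nab₄ (fun j k l m => -T j k l m) p j k l m = -S.nab₄ T p j k l m := by
  simp only [nab₄, map_neg, mul_neg, Finset.sum_neg_distrib]; ring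

lemma nab₄_smul (c : A) (T : ι → ι → ι → ι → A) (p j k l m : ι) :
    S.nab₄ (fun j k l m => c * T j k l m) p j k l m
      = S.d p c * T j k l m + c * S.nab₄ T p j k l m := by
  have h : ∀ f R : ι → A, ∑ a, f a * (c * R a) = c * ∑ a, f a * R a := fun f R => by
    rw [Finset.mul_sum]; exact Finset.sum_congr rfl fun _ _ => by ring
  simp only [nab₄, Derivation.leibniz, smul_eq_mul, h]
  ring

lemma nab₃_con (v : ι → A) (T : ι → ι → ι → ι → A) (p j k l : ι) :
    S.nab₃ (fun j k l => con v (T j k l)) p j k l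
      = con (S.nabUp v p) (T j k l) + con v (S.nab₄ T p j k l) := by
  have pull : ∀ (f : ι → A) (R : ι → ι → A),
      ∑ a, f a * ∑ m, v m * R a m = ∑ m, v m * ∑ a, f a * R a m := by
    intro f R
    simp only [Finset.mul_sum]
    rw [Finset.sum_comm]
    exact Finset.sum_congr rfl fun _ _ => Finset.sum_congr rfl fun _ _ => by ring
  have h1 := pull (fun a => S.chr a p j) (fun a m => T a k l m)
  have h2 := pull (fun a => S.chr a p k) (fun a m => T j a l m)
  have h3 := pull (fun a => S.chr a p l) (fun a m => T j k a m)
  have h4 : ∑ m, (∑ a, S.chr m p a * v a) * T j k l m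
      = ∑ m, v m * ∑ a, S.chr a p m * T j k l a := by
    simp only [Finset.mul_sum, Finset.sum_mul]
    rw [Finset.sum_comm]
    exact Finset.sum_congr rfl fun _ _ => Finset.sum_congr rfl fun _ _ => by ring
  simp only [nab₃, nab₄, con, nabUp, mul_sub, add_mul, Finset.sum_sub_distrib,
    Finset.sum_add_distrib, h1, h2, h3, h4, map_sum, Derivation.leibniz, smul_eq_mul]
  simp only [mul_comm (T j k l _)]
  ring

lemma nab₁_con (v : ι → A) (T : ι → ι → A) (p l : ι) :
    S.nab₁ (fun l => con v (fun k => T k l)) p l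
      = con (S.nabUp v p) (fun k => T k l) + con v (fun k => S.nab₂ T p k l) := by
  have h1 : ∑ a, S.chr a p l * ∑ m, v m * T m a = ∑ m, v m * ∑ a, S.chr a p l * T m a := by
    simp only [Finset.mul_sum]
    rw [Finset.sum_comm]
    exact Finset.sum_congr rfl fun _ _ => Finset.sum_congr rfl fun _ _ => by ring
  have h4 : ∑ m, (∑ a, S.chr m p a * v a) * T m l = ∑ m, v m * ∑ a, S.chr a p m * T a l := by
    simp only [Finset.mul_sum, Finset.sum_mul]
    rw [Finset.sum_comm]
    exact Finset.sum_congr rfl fun _ _ => Finset.sum_congr rfl fun _ _ => by ring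
  simp only [nab₁, nab₂, con, nabUp, mul_sub, add_mul, Finset.sum_sub_distrib,
    Finset.sum_add_distrib, h1, h4, map_sum, Derivation.leibniz, smul_eq_mul]
  simp only [mul_comm (T _ l)]
  ring

/-- Holds because the inverse metric is parallel (`d_gi`). -/
lemma d_tr (p : ι) (T : ι → ι → A) : S.d p (S.tr T) = S.tr (fun k l => S.nab₂ T p k l) := by
  have h1 : ∑ k, ∑ l, S.gi k l * ∑ a, S.chr a p k * T a l
      = ∑ k, ∑ l, (∑ a, S.chr k p a * S.gi a l) * T k l := by
    simp only [Finset.mul_sum, Finset.sum_mul]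
    rw [Finset.sum_comm]
    conv_rhs => rw [Finset.sum_comm]
    refine Finset.sum_congr rfl fun _ _ => ?_
    rw [Finset.sum_comm]
    exact Finset.sum_congr rfl fun _ _ => Finset.sum_congr rfl fun _ _ => by ring
  have h2 : ∑ k, ∑ l, S.gi k l * ∑ a, S.chr a p l * T k a
      = ∑ k, ∑ l, (∑ a, S.chr l p a * S.gi k a) * T k l := by
    simp only [Finset.mul_sum, Finset.sum_mul]
    refine Finset.sum_congr rfl fun _ _ => ?_
    rw [Finset.sum_comm]
    exact Finset.sum_congr rfl fun _ _ => Finset.sum_congr rfl fun _ _ => by ring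
  have h3 : S.d p (S.tr T) = ∑ k, ∑ l, S.gi k l * S.d p (T k l)
      + ∑ k, ∑ l, S.d p (S.gi k l) * T k l := by
    simp only [tr, map_sum, Derivation.leibniz, smul_eq_mul, Finset.sum_add_distrib,
      mul_comm (T _ _)]
  rw [h3]
  simp only [tr, nab₂, mul_sub, Finset.sum_sub_distrib, h1, h2, S.d_gi, neg_mul, add_mul,
    Finset.sum_neg_distrib, Finset.sum_add_distrib]
  ring

lemma nab₄_tr (T : ι → ι → ι → ι → A) (p j m : ι) :
    S.tr (fun k l => S.nab₄ T p j k l m) = S.nab₂ (fun j m => S.tr (fun k l => T j k l m)) p j m := by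
  have pull : ∀ (f : ι → A) (R : ι → ι → ι → A),
      S.tr (fun k l => ∑ a, f a * R a k l) = ∑ a, f a * S.tr (R a) := fun f R => by
    have := S.tr_con f (fun k l a => R a k l)
    simpa only [con] using this
  have h1 := pull (fun a => S.chr a p j) (fun a k l => T a k l m)
  have h2 := pull (fun a => S.chr a p m) (fun a k l => T j k l a)
  have h3 := S.d_tr p (fun k l => T j k l m)
  simp only [nab₂, tr_sub] at h3
  simp only [nab₄, nab₂, tr_sub, h1, h2]
  rw [h3]; ring

lemma nab₁_low (v : ι → A) (p j : ι) : S.nab₁ (S.low v) p j = ∑ k, S.g j k * S.nabUp v p k := by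
  have h1 : ∑ a, S.chr a p j * S.low v a = ∑ k, (∑ a, S.chr a p j * S.g a k) * v k := by
    simp only [low, Finset.mul_sum, Finset.sum_mul]
    rw [Finset.sum_comm]
    exact Finset.sum_congr rfl fun _ _ => Finset.sum_congr rfl fun _ _ => by ring
  have h2 : ∑ k, S.g j k * ∑ a, S.chr k p a * v a
      = ∑ k, (∑ a, S.chr a p k * S.g j a) * v k := by
    simp only [Finset.mul_sum, Finset.sum_mul]
    rw [Finset.sum_comm]
    exact Finset.sum_congr rfl fun _ _ => Finset.sum_congr rfl fun _ _ => by ring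
  simp only [nab₁, nabUp, mul_add, Finset.sum_add_distrib, h1, h2]
  have h3 : S.d p (S.low v j) = ∑ k, S.g j k * S.d p (v k) + ∑ k, S.d p (S.g j k) * v k := by
    simp only [low, map_sum, Derivation.leibniz, smul_eq_mul, Finset.sum_add_distrib,
      mul_comm (v _)]
  rw [h3]
  simp only [S.d_g, add_mul, Finset.sum_add_distrib]
  ring

/-- The Ricci identity for a covector field. -/
lemma nab₂_nab₁_comm (w : ι → A) (c d b : ι) :
    S.nab₂ (S.nab₁ w) c d b - S.nab₂ (S.nab₁ w) d c b = -∑ a, S.rup a b c d * w a := by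
  have h1 : ∀ c d, ∑ e, S.chr e c b * ∑ a, S.chr a d e * w a
      = ∑ a, (∑ e, S.chr a d e * S.chr e c b) * w a := by
    intro c d
    simp only [Finset.mul_sum, Finset.sum_mul]
    rw [Finset.sum_comm]
    exact Finset.sum_congr rfl fun _ _ => Finset.sum_congr rfl fun _ _ => by ring
  have h2 : ∑ a, S.rup a b c d * w a = ∑ a, S.d c (S.chr a d b) * w a
      - ∑ a, S.d d (S.chr a c b) * w a + (∑ a, (∑ e, S.chr a c e * S.chr e d b) * w a
        - ∑ a, (∑ e, S.chr a d e * S.chr e c b) * w a) := by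
    simp only [rup, ← Finset.sum_add_distrib, ← Finset.sum_sub_distrib]
    refine Finset.sum_congr rfl fun a _ => ?_
    simp only [Finset.sum_sub_distrib]
    ring
  rw [h2]
  simp only [nab₂, nab₁, mul_sub, Finset.sum_sub_distrib, h1, map_sub, map_sum,
    Derivation.leibniz, smul_eq_mul, Finset.sum_add_distrib, S.chr_symm _ d c, S.d_comm d c]
  simp only [mul_comm (w _)]
  ring

/-! ### The divergence of the Weyl tensor -/

lemma nab₄_wey_antisymm_right (p j k l m : ι) :
    S.nab₄ S.wey p j k l m = -S.nab₄ S.wey p j k m l := by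
  have h : S.wey = fun j k l m => -S.wey j k m l := by
    funext j k l m; exact S.wey_antisymm_right j k l m
  conv_lhs => rw [h, S.nab₄_neg (fun j k l m => S.wey j k m l), S.nab₄_swap]

lemma nab₄_wey_pair_symm (p j k l m : ι) :
    S.nab₄ S.wey p j k l m = S.nab₄ S.wey p l m j k := by
  have h : S.wey = fun j k l m => S.wey l m j k := by
    funext j k l m; exact S.wey_pair_symm j k l m
  conv_lhs => rw [h, S.nab₄_pair_swap]

lemma nab₄_riem_swap (p j k l m : ι) :
    S.nab₄ S.riem p j k l m = -S.nab₄ S.riem p m l j k := by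
  have h : S.riem = fun j k l m => -S.riem m l j k := by
    funext j k l m; rw [S.riem_pair_symm, S.riem_antisymm_left]
  conv_lhs => rw [h, S.nab₄_neg]
  congr 1
  simp only [nab₄]; ring

lemma nabRup_antisymm (p a b c d : ι) : S.nabRup p a b c d = -S.nabRup p a b d c := by
  have h : ∀ (f : ι → A) (R U : ι → A), (∀ e, R e = -U e) →
      ∑ e, f e * R e = -∑ e, f e * U e := fun f R U hRU => by
    simp [hRU]
  rw [nabRup, nabRup, S.rup_antisymm a b c d, map_neg, h _ _ _ fun e => S.rup_antisymm e b c d,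
    h _ _ _ fun e => S.rup_antisymm a e c d, h _ _ _ fun e => S.rup_antisymm a b e d,
    h _ _ _ fun e => S.rup_antisymm a b c e]
  ring

/-- The contracted second Bianchi identity. -/
lemma div_riem (j k l : ι) : S.tr (fun m p => S.nab₄ S.riem p j k l m)
    = -(S.nab₂ S.ric j l k - S.nab₂ S.ric k l j) := by
  have h1 : ∀ p, ∑ m, S.gi p m * S.nab₄ S.riem p m l j k = S.nabRup p p l j k := fun p => by
    simp only [nab_riem]
    exact S.sum_gi_mul_sum_g p (fun e => S.nabRup p e l j k)
  have h2 : ∀ a, S.nabRup j a l k a = -S.nabRup j a l a k := fun a => S.nabRup_antisymm ..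
  have h3 : S.tr (fun m p => S.nab₄ S.riem p m l j k) = ∑ p, S.nabRup p p l j k := by
    rw [tr, Finset.sum_comm]
    refine Finset.sum_congr rfl fun p _ => ?_
    rw [← h1 p]
    exact Finset.sum_congr rfl fun _ _ => by rw [S.gi_symm]
  -- The second Bianchi identity, with the derivative index of the first term contracted with the
  -- upper curvature index.
  have h4 : ∑ p, S.nabRup p p l j k + ∑ p, S.nabRup j p l k p + ∑ p, S.nabRup k p l p j = 0 := by
    simp only [← Finset.sum_add_distrib, nabRup_bianchi, Finset.sum_const_zero]
  simp only [h2, Finset.sum_neg_distrib, ← nab_ric] at h4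
  simp only [S.nab₄_riem_swap _ j k l _, tr_neg, h3]
  linear_combination -h4

lemma nab₄_wey (p j k l m : ι) : S.nab₄ S.wey p j k l m = S.nab₄ S.riem p j k l m
    - weylCoeff ι A * (S.g j l * S.nab₂ S.ric p k m - S.g j m * S.nab₂ S.ric p k l
      + S.g k m * S.nab₂ S.ric p j l - S.g k l * S.nab₂ S.ric p j m)
    + weylCoeff' ι A * S.d p S.scal * (S.g j l * S.g k m - S.g j m * S.g k l) := by
  have e1 := S.nab₄_mul S.g S.ric
  have e2 := S.nab₄_mul S.ric S.g
  have e3 := S.nab₄_mul S.g S.g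
  have f1 := S.nab₄_swap (fun j k l m => S.g j l * S.ric k m) p j k l m
  have f2 := S.nab₄_swap (fun j k l m => S.ric j l * S.g k m) p j k l m
  have f3 := S.nab₄_swap (fun j k l m => S.g j l * S.g k m) p j k l m
  have h : S.wey = fun j k l m => S.riem j k l m
    - weylCoeff ι A * (S.g j l * S.ric k m - S.g j m * S.ric k l + S.ric j l * S.g k m
        - S.ric j m * S.g k l)
    + weylCoeff' ι A * S.scal * (S.g j l * S.g k m - S.g j m * S.g k l) := by
    funext j k l m; rw [wey]; ring
  have c1 : S.d p (weylCoeff ι A) = 0 := Derivation.map_algebraMap _ _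
  have c2 : S.d p (weylCoeff' ι A) = 0 := Derivation.map_algebraMap _ _
  rw [h]
  simp only [nab₄_add, nab₄_sub, nab₄_smul, e1, e2, e3, f1, f2, f3, nab₂_g, c1,
    Derivation.leibniz, c2, smul_eq_mul]
  ring

/-- The coefficient is -1 from the contracted Bianchi identity plus 1/(n-2) from the Ricci terms of
C. The covector y collects the divergence of Ric and the gradient of R; its value is irrelevant,
since `eq_zero_of_contractions_eq_zero` handles any term of this shape. -/
lemma divWey_eq : ∃ y : ι → A, ∀ j k l, S.divWey j k l =
    (weylCoeff ι A - 1) * (S.nab₂ S.ric j k l - S.nab₂ S.ric k j l)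
      + S.g k l * y j - S.g j l * y k := by
  refine ⟨fun j => weylCoeff ι A * S.tr (fun m p => S.nab₂ S.ric p j m)
    - weylCoeff' ι A * S.d j S.scal, fun j k l => ?_⟩
  have hs : ∀ p j k, S.nab₂ S.ric p j k = S.nab₂ S.ric p k j := fun p j k => by
    simp only [nab₂, S.ric_symm k j, S.ric_symm k, S.ric_symm _ j]; ring
  simp only [divWey, nab₄_wey, tr_add, tr_sub, tr_const_mul, div_riem, mul_sub, mul_assoc]
  have t1 : ∀ a b c, S.tr (fun m p => S.g a m * S.nab₂ S.ric p b c) = S.nab₂ S.ric a b c :=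
    fun a b c => S.tr_g_mul a (fun p => S.nab₂ S.ric p b c)
  have t2 : S.tr (fun m p => S.d p S.scal * (S.g j l * S.g k m)) = S.g j l * S.d k S.scal := by
    rw [← S.tr_g_mul k (fun p => S.d p S.scal), ← S.tr_const_mul]
    congr 1; funext m p; ring
  have t3 : S.tr (fun m p => S.d p S.scal * (S.g j m * S.g k l)) = S.g k l * S.d j S.scal := by
    rw [← S.tr_g_mul j (fun p => S.d p S.scal), ← S.tr_const_mul]
    congr 1; funext m p; ring
  rw [t1, t1, t2, t3, hs j l k, hs k l j]
  ring

lemma tr_tr (T : ι → ι → ι → ι → A) : S.tr (fun k l => S.tr (fun m p => T k l m p))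
    = S.tr (fun m p => S.tr (fun k l => T k l m p)) := by
  have h : ∀ U : ι → ι → A, S.tr U = ∑ x : ι × ι, S.gi x.1 x.2 * U x.1 x.2 := fun U =>
    (Fintype.sum_prod_type' fun i j => S.gi i j * U i j).symm
  simp only [h, Finset.mul_sum]
  rw [Finset.sum_comm]
  exact Finset.sum_congr rfl fun _ _ => Finset.sum_congr rfl fun _ _ => by ring

/-- The trace commutes with ∇ and with the trace defining the divergence, and C is trace-free. -/
lemma tr_divWey (h : 3 ≤ Fintype.card ι) (j : ι) : S.tr (fun k l => S.divWey j k l) = 0 := by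
  have h1 : ∀ j m, S.tr (fun k l => S.wey j k l m) = 0 := fun j m => by
    simp only [S.wey_antisymm_left j, tr_neg, S.tr_wey h, neg_zero]
  have h2 : ∀ p m, S.tr (fun k l => S.nab₄ S.wey p j k l m) = 0 := fun p m => by
    rw [nab₄_tr]; simp [h1, nab₂]
  have h3 : S.tr (fun k l => S.divWey j k l)
      = S.tr (fun m p => S.tr (fun k l => S.nab₄ S.wey p j k l m)) := S.tr_tr _
  rw [h3]; simp [h2, tr_zero]

/-- The contraction with v on the last index determines Q, the one on the first index determines P
up to multiples of v_k, and the trace then disposes of s. -/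
lemma eq_zero_of_contractions_eq_zero (h : 3 ≤ Fintype.card ι) {v : ι → A} (hv : con v (S.low v) = -1)
    {D : ι → ι → ι → A} {s : ι → A} {P Q : ι → ι → A}
    (hD : ∀ j k l, D j k l = S.g k l * s j - S.g j l * s k + S.low v j * P k l
      - S.low v k * P j l + S.low v l * Q j k)
    (h1 : ∀ k l, con v (fun j => D j k l) = 0) (h3 : ∀ j k, con v (D j k) = 0)
    (ht : ∀ j, S.tr (D j) = 0) (j k l : ι) : D j k l = 0 := by
  have hQ : ∀ j k, Q j k = S.low v k * s j - S.low v j * s k + S.low v j * con v (P k)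
      - S.low v k * con v (P j) := by
    intro j k
    have := h3 j k
    rw [show D j k = fun l => _ from funext (hD j k)] at this
    simp only [con_add, con_sub, con_const_mul, con_mul_const, con_g_right, hv] at this
    linear_combination -this
  -- The left side is the coefficient of v_j in D once Q is eliminated. The multiple of v_k on the
  -- right drops out when v_j times this expression is antisymmetrised in j, k.
  have hP : ∀ k l, P k l - S.low v l * (s k - con v (P k)) = S.g k l * con v s
      + S.low v k * (S.low v l * con v s - con v (fun j => P j l)
        - S.low v l * con v (fun j => con v (P j))) - S.low v l * s k := by
    intro k l
    have := h1 k l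
    rw [show (fun j => D j k l) = fun j => _ from funext fun j => hD j k l] at this
    simp only [hQ, con_add, con_sub, con_const_mul, con_mul_const, con_g_left, hv] at this
    linear_combination -this
  have hform : ∀ j k l, D j k l = (S.g k l + S.low v k * S.low v l) * (s j + con v s * S.low v j)
      - (S.g j l + S.low v j * S.low v l) * (s k + con v s * S.low v k) := by
    intro j k l
    rw [hD, hQ]
    linear_combination S.low v j * hP k l - S.low v k * hP j l
  -- Here r = s + (v·s) v is the part of s orthogonal to v, and tr h = n - 1, so the trace of
  -- `hform` is (n - 1) r_j - r_j.
  have hr : ∀ j, s j + con v s * S.low v j = 0 := by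
    intro j
    have := ht j
    rw [show D j = fun k l => _ from funext fun k => funext fun l => hform j k l] at this
    have e1 : S.tr (fun k l => S.g j l * (s k + con v s * S.low v k)) =
        s j + con v s * S.low v j := S.tr_g_mul_swap j (fun k => s k + con v s * S.low v k)
    have e2 : S.tr (fun k l => S.low v l * (s k + con v s * S.low v k)) = 0 := by
      rw [S.tr_low_mul_swap v (fun k => s k + con v s * S.low v k), con_add, con_const_mul]
      linear_combination con v s * hv
    simp only [add_mul _ _ (s _ + _), tr_add, tr_sub, tr_mul_const, mul_assoc, tr_const_mul,
      tr_g, tr_low_mul, con_mul_const, hv, e1, e2] at this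
    linear_combination weylCoeff ι A * this -
      (s j + con v s * S.low v j) * weylCoeff_mul (A := A) h
  rw [hform, hr, hr]; ring

/-! ### Torse-forming unit time-like vector fields -/

/-- The vector field `v` is unit time-like and torse-forming, with `∇_i v_j = φ (g_ij + v_i v_j)`. -/
structure IsTorse (v : ι → A) (φ : A) : Prop where
  unit : con v (S.low v) = -1
  torse : ∀ i j, S.nab₁ (S.low v) i j = φ * (S.g i j + S.low v i * S.low v j)

/-- The covector field `∂_j φ - φ² v_j`. -/
def torseGrad (v : ι → A) (φ : A) (j : ι) : A := S.d j φ - φ ^ 2 * S.low v j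

variable {S} {v : ι → A} {φ : A}

namespace IsTorse

lemma nabUp_eq (h : S.IsTorse v φ) (p m : ι) :
    S.nabUp v p m = φ * ((if m = p then 1 else 0) + S.low v p * v m) := by
  have h1 : ∑ j, S.gi m j * S.low v j = v m := S.sum_gi_mul_sum_g m v
  rw [← S.sum_gi_mul_sum_g m (S.nabUp v p), ← S.sum_gi_g m p, ← h1]
  simp only [← S.nab₁_low, h.torse, mul_add, Finset.mul_sum, ← Finset.sum_add_distrib]
  exact Finset.sum_congr rfl fun _ _ => by rw [S.symm p]; ring

lemma con_nabUp (h : S.IsTorse v φ) (p : ι) (f : ι → A) :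
    con (S.nabUp v p) f = φ * (f p + S.low v p * con v f) := by
  have : ∀ m, S.nabUp v p m * f m
      = φ * (if m = p then f m else 0) + φ * S.low v p * (v m * f m) := fun m => by
    rw [h.nabUp_eq]; split_ifs <;> ring
  simp only [con, this, Finset.sum_add_distrib, ← Finset.mul_sum, Finset.sum_ite_eq',
    Finset.mem_univ, if_true]
  ring

/-- The Ricci identity with ∇v = φh: the commutator of second derivatives produces dφ from the
factor φ and -φ² v from differentiating v_k v_l. -/
lemma con_riem (h : S.IsTorse v φ) (j k l : ι) : con v (S.riem j k l) =
    S.torseGrad v φ j * (S.g k l + S.low v k * S.low v l)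
      - S.torseGrad v φ k * (S.g j l + S.low v j * S.low v l) := by
  have h1 := S.nab₂_nab₁_comm (S.low v) j k l
  have h2 : ∀ c d b, S.nab₂ (S.nab₁ (S.low v)) c d b =
      S.d c φ * (S.g d b + S.low v d * S.low v b)
        + φ * (S.nab₁ (S.low v) c d * S.low v b + S.low v d * S.nab₁ (S.low v) c b) := by
    intro c d b
    have e : S.nab₁ (S.low v) = fun i j => φ * (S.g i j + S.low v i * S.low v j) := by
      funext i j; exact h.torse i j
    conv_lhs => rw [e]
    rw [nab₂_smul, nab₂_add, nab₂_mul, nab₂_g, zero_add]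
  have h3 : ∑ a, S.rup a l j k * S.low v a = -con v (S.riem j k l) := by
    have e : ∀ m, S.riem j k l m = -S.riem m l j k := fun m => by
      rw [S.riem_pair_symm, S.riem_antisymm_left]
    have e2 : con v (S.riem j k l) = -∑ m, v m * S.riem m l j k := by
      simp only [con, e, mul_neg, Finset.sum_neg_distrib]
    rw [e2, neg_neg]
    simp only [low, riem, Finset.mul_sum]
    rw [Finset.sum_comm]
    exact Finset.sum_congr rfl fun _ _ => Finset.sum_congr rfl fun _ _ => by
      rw [S.symm]; ring
  rw [h2, h2, h.torse, h.torse, h.torse, h.torse, h3, S.symm k j] at h1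
  simp only [torseGrad]
  linear_combination -h1

lemma con_ric (h : S.IsTorse v φ) (k : ι) : con v (S.ric k) =
    con v (S.torseGrad v φ) * S.low v k - ((Fintype.card ι : A) - 2) * S.torseGrad v φ k := by
  have h1 := S.tr_con v (fun j l m => S.riem j k l m)
  have e1 : ∀ m, S.tr (fun j l => S.riem j k l m) = S.ric k m := fun m => S.tr_riem k m
  have e2 : S.tr (fun j l => S.torseGrad v φ j * S.g k l) = S.torseGrad v φ k := by
    rw [← S.tr_g_mul_swap k (S.torseGrad v φ)]
    simp only [mul_comm]
  have e3 : S.tr (fun j l => S.torseGrad v φ j * (S.low v k * S.low v l))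
      = con v (S.torseGrad v φ) * S.low v k := by
    rw [← S.tr_low_mul_swap v (S.torseGrad v φ), ← S.tr_mul_const]
    congr 1; funext j l; ring
  simp only [e1] at h1
  change S.tr (fun j l => con v (S.riem j k l)) = con v (S.ric k) at h1
  rw [← h1]
  simp only [h.con_riem, tr_sub, tr_const_mul, mul_add, tr_add, e2, e3, tr_g, tr_low_mul, h.unit]
  ring

variable (S v φ) in
/-- The tensor `F_jl` for which `v^m C_jklm = v_k F_jl - v_j F_kl`. -/
def weylPart (j l : ι) : A :=
  S.torseGrad v φ j * S.low v l - weylCoeff ι A * S.ric j l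
    + (weylCoeff' ι A * S.scal - weylCoeff ι A * con v (S.torseGrad v φ)) * S.g j l

/-- The terms g_kl t_j coming from the Riemann tensor and from v^m R_km cancel, since the latter
carries n - 2 against the coefficient 1/(n-2) in C. Everything left has a factor v_j or v_k. -/
lemma con_wey (hn : 3 ≤ Fintype.card ι) (h : S.IsTorse v φ) (j k l : ι) : con v (S.wey j k l) =
    S.low v k * weylPart S v φ j l - S.low v j * weylPart S v φ k l := by
  have e : S.wey j k l = fun m => S.wey j k l m := rfl
  rw [e]
  simp only [wey, con_add, con_sub, con_const_mul, con_mul_const, con_g_right,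
    h.con_riem, h.con_ric, weylPart]
  linear_combination (S.g j l * S.torseGrad v φ k - S.g k l * S.torseGrad v φ j) *
    weylCoeff_mul (A := A) hn

/-- The tensor `E_kl = v^j v^m C_jklm`. -/
def _root_.DiffMetric.elec (S : DiffMetric ι A) (v : ι → A) (k l : ι) : A :=
  con v (fun j => con v (S.wey j k l))

lemma elec_eq (hn : 3 ≤ Fintype.card ι) (h : S.IsTorse v φ) (k l : ι) : S.elec v k l =
    S.low v k * con v (fun j => weylPart S v φ j l) + weylPart S v φ k l := by
  simp only [elec, h.con_wey hn, con_sub, con_const_mul, con_mul_const, h.unit]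
  ring

/-- `weylPart` and `elec` differ by a multiple of v_k, which the antisymmetrisation does not see. -/
lemma con_wey_eq_elec (hn : 3 ≤ Fintype.card ι) (h : S.IsTorse v φ) (j k l : ι) :
    con v (S.wey j k l) = S.low v k * S.elec v j l - S.low v j * S.elec v k l := by
  rw [h.elec_eq hn, h.elec_eq hn, h.con_wey hn]; ring

end IsTorse

/-- Contracts v^j v^k with a tensor antisymmetric in j, k. -/
lemma con_elec (S : DiffMetric ι A) (v : ι → A) (l : ι) :
    con v (fun k => S.elec v k l) = 0 := by
  have h1 : con v (fun k => S.elec v k l) = -con v (fun k => S.elec v k l) := by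
    have e : ∀ j k, con v (S.wey j k l) = -con v (S.wey k j l) := fun j k => by
      rw [← con_neg]; congr 1; funext m; exact S.wey_antisymm_left j k l m
    conv_lhs => rw [show S.elec v = _ from rfl]; unfold elec; rw [con_con]
    simp only [elec, ← con_neg, ← e]
  refine isUnit_two.mul_left_cancel ?_
  linear_combination h1

/-! ### The two assertions over the ring -/

namespace IsTorse

lemma divWey_eq_zero (hn : 3 ≤ Fintype.card ι) (h : S.IsTorse v φ)
    (hX : ∀ j k l, con v (S.wey j k l) = 0) (j k l : ι) : S.divWey j k l = 0 := by
  -- contracting the divergence with `v`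
  have hnab : ∀ p j k l, con v (S.nab₄ S.wey p j k l) = -(φ * S.wey j k l p) := fun p j k l => by
    have h1 := S.nab₃_con v S.wey p j k l
    rw [h.con_nabUp, hX] at h1
    simp only [hX] at h1
    simp only [nab₃, map_zero, mul_zero, Finset.sum_const_zero, sub_zero] at h1
    linear_combination -h1
  -- By `hnab` this is φ times the trace of C over its antisymmetric last pair.
  have hD3 : ∀ j k, con v (S.divWey j k) = 0 := fun j k => by
    have e : S.divWey j k = fun l => S.tr (fun m p => S.nab₄ S.wey p j k l m) := rfl
    rw [e, ← S.tr_con v (fun m p l => S.nab₄ S.wey p j k l m)]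
    have : ∀ p m, con v (fun l => S.nab₄ S.wey p j k l m) = φ * S.wey j k m p := fun p m => by
      simp only [S.nab₄_wey_antisymm_right p j k _ m, con_neg]
      have := hnab p j k m
      linear_combination -this
    simp only [this, tr_const_mul]
    rw [S.tr_eq_zero_of_antisymm fun m p => S.wey_antisymm_right j k m p, mul_zero]
  -- Pair symmetry moves the contracted index to the last slot, where `hnab` applies; a trace of C
  -- remains.
  have hD1 : ∀ k l, con v (fun j => S.divWey j k l) = 0 := fun k l => by
    simp only [divWey]
    rw [← S.tr_con v (fun m p j => S.nab₄ S.wey p j k l m)]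
    have : ∀ p m, con v (fun j => S.nab₄ S.wey p j k l m) = φ * S.wey l m k p := fun p m => by
      simp only [S.nab₄_wey_pair_symm p _ k l m, S.nab₄_wey_antisymm_right p l m _ k, con_neg]
      have := hnab p l m k
      linear_combination -this
    have e : ∀ m p, S.wey l m k p = S.wey m l p k := fun m p => by
      rw [S.wey_antisymm_left, S.wey_antisymm_right, neg_neg]
    simp only [this, tr_const_mul, e, S.tr_wey hn, mul_zero]
  -- the Ricci tensor
  have hF : ∀ k l, weylPart S v φ k l = -(S.low v k * con v (fun j => weylPart S v φ j l)) := by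
    intro k l
    have h1 := h.elec_eq hn k l
    simp only [elec, hX, con_zero] at h1
    linear_combination -h1
  -- By `hF`, `weylPart` equals -v_k f_l. Solving its definition for Ric, that is multiplying by n -
  -- 2, gives the coefficients β, a and b.
  set f : ι → A := fun l => con v (fun j => weylPart S v φ j l) with hf
  set β : A := ((Fintype.card ι : A) - 2) *
    (weylCoeff' ι A * S.scal - weylCoeff ι A * con v (S.torseGrad v φ)) with hβ
  set a : ι → A := fun j => ((Fintype.card ι : A) - 2) * S.torseGrad v φ j with ha
  set b : ι → A := fun j => ((Fintype.card ι : A) - 2) * f j with hb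
  have hric : S.ric = fun k l => β * S.g k l + a k * S.low v l + S.low v k * b l := by
    funext k l
    have h1 : weylPart S v φ k l = -(S.low v k * f l) := hF k l
    rw [weylPart] at h1
    simp only [ha, hb, hβ]
    linear_combination (-((Fintype.card ι : A) - 2)) * h1
      - S.ric k l * weylCoeff_mul (A := A) hn
  have hnric : ∀ p k l, S.nab₂ S.ric p k l = S.d p β * S.g k l
      + (S.nab₁ a p k * S.low v l + a k * S.nab₁ (S.low v) p l)
      + (S.nab₁ (S.low v) p k * b l + S.low v k * S.nab₁ b p l) := fun p k l => by
    rw [hric, nab₂_add, nab₂_add, nab₂_smul, nab₂_mul, nab₂_mul, nab₂_g, mul_zero, add_zero]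
  obtain ⟨y, hy⟩ := S.divWey_eq
  set c : A := weylCoeff ι A - 1
  -- Witnesses from antisymmetrising ∇Ric: P comes from v_k ∇b, Q from v_l ∇a and the v v part of a
  -- ∇v, s from dβ and the g part of a ∇v. The term b_l ∇_j v_k is symmetric in j, k and disappears.
  refine S.eq_zero_of_contractions_eq_zero hn h.unit (D := S.divWey)
    (P := fun k l => -c * S.nab₁ b k l)
    (Q := fun j k => c * (S.nab₁ a j k - S.nab₁ a k j) + c * φ * (a k * S.low v j - a j * S.low v k))
    (s := fun j => y j + c * (S.d j β - φ * a j)) (fun j k l => ?_) hD1 hD3 (S.tr_divWey hn) j k l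
  rw [hy, hnric, hnric]
  simp only [h.torse]
  rw [S.symm k j]
  ring

lemma nab_con_wey (hn : 3 ≤ Fintype.card ι) (h : S.IsTorse v φ)
    (hD : ∀ j k l, S.divWey j k l = 0) (j k l : ι) :
    con v (fun p => S.nab₃ (fun j k l => con v (S.wey j k l)) p j k l)
      = -(φ * ((Fintype.card ι : A) - 1)) * con v (S.wey j k l) := by
  set E := S.elec v with hE
  have hX : (fun j k l => con v (S.wey j k l))
      = fun j k l => S.low v k * E j l - S.low v j * E k l := by
    funext j k l; exact h.con_wey_eq_elec hn j k l
  have hN : ∀ p j k l, S.nab₃ (fun j k l => con v (S.wey j k l)) p j k l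
      = φ * ((S.g p k + S.low v p * S.low v k) * E j l
          - (S.g p j + S.low v p * S.low v j) * E k l)
        + S.low v k * S.nab₂ E p j l - S.low v j * S.nab₂ E p k l := fun p j k l => by
    rw [hX, nab₃_sub, S.nab₃_swap (fun j k l => S.low v k * E j l), nab₃_mul, nab₃_mul, h.torse,
      h.torse]
    ring
  have hEv : ∀ l, con v (fun k => E k l) = 0 := S.con_elec v
  -- the divergence of the contraction
  have hdiv : ∀ k l, S.tr (fun j p => S.nab₃ (fun j k l => con v (S.wey j k l)) p j k l)
      = φ * E k l := fun k l => by
    have h1 : ∀ p j, S.nab₃ (fun j k l => con v (S.wey j k l)) p j k l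
        = φ * (S.wey j k l p + S.low v p * con v (S.wey j k l))
          + con v (S.nab₄ S.wey p j k l) := fun p j => by
      rw [S.nab₃_con, h.con_nabUp]
    have h2 : S.tr (fun j p => S.wey j k l p) = 0 := by
      simp only [S.wey_antisymm_right _ k l, tr_neg, S.tr_wey hn, neg_zero]
    have h3 : S.tr (fun j p => S.low v p * con v (S.wey j k l)) = E k l :=
      S.tr_low_mul_swap v (fun j => con v (S.wey j k l))
    -- By the symmetries of C, this is -v^m D_lmk.
    have h4 : S.tr (fun j p => con v (S.nab₄ S.wey p j k l)) = 0 := by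
      rw [S.tr_con v (fun j p m => S.nab₄ S.wey p j k l m)]
      have : ∀ m p j, S.nab₄ S.wey p j k l m = -S.nab₄ S.wey p l m k j := fun m p j => by
        rw [S.nab₄_wey_pair_symm, S.nab₄_wey_antisymm_right]
      simp only [this, tr_neg]
      have e : ∀ m, S.tr (fun j p => S.nab₄ S.wey p l m k j) = 0 := fun m => hD l m k
      simp only [e, neg_zero, con_zero]
    simp only [h1, tr_add, tr_const_mul, h2, h3, h4]
    ring
  set Y : ι → A := fun l => S.tr (fun j p => S.nab₂ E p j l) with hY
  -- Compare `hdiv` with the trace of `hN`. The latter contributes φ(1 - (n - 1)) E_kl, as tr h = n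
  -- - 1 and E is orthogonal to v.
  have hvE : ∀ k l, con v (fun p => S.nab₂ E p k l)
      = -(φ * ((Fintype.card ι : A) - 1)) * E k l + S.low v k * Y l := fun k l => by
    have h1 := hdiv k l
    have t1 : S.tr (fun j p => S.g p k * E j l) = E k l := S.tr_g_mul_swap' k (fun j => E j l)
    have t2 : S.tr (fun j p => S.low v p * S.low v k * E j l) = 0 := by
      simp only [mul_comm (S.low v _) (S.low v k), mul_assoc, tr_const_mul]
      rw [S.tr_low_mul_swap v (fun j => E j l), hEv, mul_zero]
    have t3 : S.tr (fun j p => S.g p j) = Fintype.card ι := by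
      rw [← S.tr_g]; exact S.tr_swap (fun j p => S.g j p)
    have t4 : S.tr (fun j p => S.low v p * S.low v j) = -1 := by
      rw [S.tr_low_mul_swap v, h.unit]
    have t5 : S.tr (fun j p => S.low v j * S.nab₂ E p k l) = con v (fun p => S.nab₂ E p k l) :=
      S.tr_low_mul v (fun p => S.nab₂ E p k l)
    simp only [hN, tr_add, tr_sub, tr_const_mul, add_mul (S.g _ k), tr_mul_const, t1, t2, t3, t4,
      t5] at h1
    linear_combination -h1
  -- Evaluate v^k v^p ∇_p E_kl twice. By `hvE` it is -Y_l; differentiating v^k E_kl = 0 turns it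
  -- into -φ v^p E_pl = 0.
  have hY0 : ∀ l, Y l = 0 := fun l => by
    have h1 : ∀ p, con v (fun k => S.nab₂ E p k l) = -(φ * E p l) := fun p => by
      have := S.nab₁_con v E p l
      simp only [hEv, nab₁, map_zero, mul_zero, Finset.sum_const_zero, sub_zero,
        h.con_nabUp] at this
      linear_combination -this
    have h2 := con_con v v (fun k p => S.nab₂ E p k l)
    simp only [hvE, h1, con_add, con_const_mul, con_neg, con_mul_const, hEv, h.unit] at h2
    linear_combination -h2
  have t1 : ∀ k, con v (fun p => S.g p k + S.low v p * S.low v k) = 0 := fun k => by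
    rw [con_add, con_g_left, con_mul_const, h.unit]; ring
  simp only [hN, con_add, con_sub, con_const_mul, con_mul_const, hvE, hY0, con_g_left]
  rw [h.con_wey_eq_elec hn, show con v (fun p => S.low v p) = -1 from h.unit]
  ring

end IsTorse

end DiffMetric

/-! ## Smooth functions on an open set of `ℝⁿ` -/

section SmoothFunctions

variable {n : ℕ} {U : Set (EuclideanSpace ℝ (Fin n))}

open CoordTensor

lemma extend_val_apply (f : U → ℝ) {y : EuclideanSpace ℝ (Fin n)} (hy : y ∈ U) :
    Function.extend Subtype.val f 0 y = f ⟨y, hy⟩ :=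
  Subtype.val_injective.extend_apply f 0 ⟨y, hy⟩

variable (U) in
/-- The algebra of smooth functions on `U`. -/
def smoothFun : Subalgebra ℝ (U → ℝ) where
  -- The extension by 0 makes `fderiv` applicable. Its values off U do not matter, because
  -- derivatives are taken only at points of the open set U.
  carrier := {f | ContDiffOn ℝ ∞ (Function.extend Subtype.val f 0) U}
  mul_mem' {f h} hf hh := (hf.mul hh).congr fun y hy => by
    simp [extend_val_apply _ hy]
  add_mem' {f h} hf hh := (hf.add hh).congr fun y hy => by
    simp [extend_val_apply _ hy]
  algebraMap_mem' r := (contDiffOn_const (c := r)).congr fun y hy => by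
    simp [extend_val_apply _ hy]

/-- The function `F` restricts to the smooth function `f` on `U`. -/
def Restricts (F : EuclideanSpace ℝ (Fin n) → ℝ) (f : smoothFun U) : Prop :=
  ∀ y, ∀ hy : y ∈ U, f.1 ⟨y, hy⟩ = F y

/-- The restriction of a function that is smooth on `U`. -/
def restrictSmooth {F : EuclideanSpace ℝ (Fin n) → ℝ} (hF : ContDiffOn ℝ ∞ F U) : smoothFun U :=
  ⟨fun y => F y, hF.congr fun _ hy => extend_val_apply _ hy⟩

lemma restricts_restrictSmooth {F : EuclideanSpace ℝ (Fin n) → ℝ} (hF : ContDiffOn ℝ ∞ F U) :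
    Restricts F (restrictSmooth hF) := fun _ _ => rfl

lemma contDiffOn_pd (hU : IsOpen U) {F : EuclideanSpace ℝ (Fin n) → ℝ}
    (hF : ContDiffOn ℝ ∞ F U) (i : Fin n) : ContDiffOn ℝ ∞ (pd i F) U :=
  (hF.fderiv_of_isOpen hU (m := ∞) (by norm_num)).clm_apply contDiffOn_const

lemma pd_congr (hU : IsOpen U) {F H : EuclideanSpace ℝ (Fin n) → ℝ} (h : Set.EqOn F H U)
    (i : Fin n) {y : EuclideanSpace ℝ (Fin n)} (hy : y ∈ U) : pd i F y = pd i H y := by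
  rw [pd, pd, (h.eventuallyEq_of_mem (hU.mem_nhds hy)).fderiv_eq]

lemma pd_comm (hU : IsOpen U) {F : EuclideanSpace ℝ (Fin n) → ℝ} (hF : ContDiffOn ℝ ∞ F U)
    (i j : Fin n) {y : EuclideanSpace ℝ (Fin n)} (hy : y ∈ U) :
    pd i (pd j F) y = pd j (pd i F) y := by
  have hFy : ContDiffAt ℝ ∞ F y := hF.contDiffAt (hU.mem_nhds hy)
  have hd : DifferentiableAt ℝ (fderiv ℝ F) y :=
    (hFy.fderiv_right (m := 1) (by norm_cast)).differentiableAt one_ne_zero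
  have hsymm : IsSymmSndFDerivAt ℝ F y := hFy.isSymmSndFDerivAt (by simp; norm_cast)
  have key : ∀ a b : Fin n, pd a (pd b F) y
      = fderiv ℝ (fderiv ℝ F) y (EuclideanSpace.single a 1) (EuclideanSpace.single b 1) := by
    intro a b
    unfold pd
    rw [fderiv_clm_apply hd (differentiableAt_const _)]
    simp
  rw [key, key, hsymm]

/-- The partial derivative as a derivation of the algebra of smooth functions. -/
def smoothPd (hU : IsOpen U) (i : Fin n) : Derivation ℝ (smoothFun U) (smoothFun U) where
  toFun f := restrictSmooth (contDiffOn_pd hU f.2 i)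
  map_add' f h := by
    ext ⟨y, hy⟩
    have hf := (f.2.contDiffAt (hU.mem_nhds hy)).differentiableAt (by simp)
    have hh := (h.2.contDiffAt (hU.mem_nhds hy)).differentiableAt (by simp)
    change pd i (Function.extend Subtype.val (f.1 + h.1) 0) y = pd i _ y + pd i _ y
    rw [pd_congr hU (H := Function.extend Subtype.val f.1 0 + Function.extend Subtype.val h.1 0)
      (fun z hz => by simp [extend_val_apply _ hz]) i hy, pd, fderiv_add hf hh]
    rfl
  map_smul' r f := by
    ext ⟨y, hy⟩
    have hf := (f.2.contDiffAt (hU.mem_nhds hy)).differentiableAt (by simp)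
    change pd i (Function.extend Subtype.val (r • f.1) 0) y = r * pd i _ y
    rw [pd_congr hU (H := r • Function.extend Subtype.val f.1 0)
      (fun z hz => by simp [extend_val_apply _ hz]) i hy, pd, fderiv_const_smul hf]
    rfl
  map_one_eq_zero' := by
    ext ⟨y, hy⟩
    change pd i (Function.extend Subtype.val (1 : U → ℝ) 0) y = 0
    rw [pd_congr hU (H := fun _ => 1) (fun z hz => by simp [extend_val_apply _ hz]) i hy, pd]
    simp
  leibniz' f h := by
    ext ⟨y, hy⟩
    have hf := (f.2.contDiffAt (hU.mem_nhds hy)).differentiableAt (by simp)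
    have hh := (h.2.contDiffAt (hU.mem_nhds hy)).differentiableAt (by simp)
    change pd i (Function.extend Subtype.val (f.1 * h.1) 0) y
      = f.1 ⟨y, hy⟩ * pd i _ y + h.1 ⟨y, hy⟩ * pd i _ y
    rw [pd_congr hU (H := Function.extend Subtype.val f.1 0 * Function.extend Subtype.val h.1 0)
      (fun z hz => by simp [extend_val_apply _ hz]) i hy, pd, fderiv_mul hf hh,
      extend_val_apply _ hy, extend_val_apply _ hy]
    rfl

namespace Restricts

variable {F H : EuclideanSpace ℝ (Fin n) → ℝ} {f h : smoothFun U}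

lemma add (hF : Restricts F f) (hH : Restricts H h) : Restricts (fun y => F y + H y) (f + h) :=
  fun y hy => congrArg₂ (· + ·) (hF y hy) (hH y hy)

lemma neg (hF : Restricts F f) : Restricts (fun y => -F y) (-f) :=
  fun y hy => congrArg Neg.neg (hF y hy)

lemma sub (hF : Restricts F f) (hH : Restricts H h) : Restricts (fun y => F y - H y) (f - h) :=
  fun y hy => congrArg₂ (· - ·) (hF y hy) (hH y hy)

lemma mul (hF : Restricts F f) (hH : Restricts H h) : Restricts (fun y => F y * H y) (f * h) :=
  fun y hy => congrArg₂ (· * ·) (hF y hy) (hH y hy)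

lemma const (r : ℝ) : Restricts (fun _ => r) (algebraMap ℝ (smoothFun U) r) := fun _ _ => rfl

lemma sum {ι : Type*} (s : Finset ι) {F : ι → EuclideanSpace ℝ (Fin n) → ℝ}
    {f : ι → smoothFun U} (hF : ∀ i, Restricts (F i) (f i)) :
    Restricts (fun y => ∑ i ∈ s, F i y) (∑ i ∈ s, f i) := fun y hy => by
  simp only [AddSubmonoidClass.coe_finsetSum, Finset.sum_apply]
  exact Finset.sum_congr rfl fun i _ => hF i y hy

lemma pd (hU : IsOpen U) (hF : Restricts F f) (i : Fin n) :
    Restricts (pd i F) (smoothPd hU i f) := fun _ hy =>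
  pd_congr hU (fun z hz => by rw [extend_val_apply _ hz, hF z hz]) i hy

lemma eq_iff (hF : Restricts F f) (hH : Restricts H h) : f = h ↔ ∀ y ∈ U, F y = H y := by
  refine ⟨fun e y hy => by rw [← hF y hy, ← hH y hy, e], fun e => ?_⟩
  ext ⟨y, hy⟩
  rw [hF y hy, hH y hy, e y hy]

end Restricts

end SmoothFunctions

/-! ### Coordinate tensors as elements of the algebra of smooth functions -/

section CoordMetric

variable {n : ℕ} {U : Set (EuclideanSpace ℝ (Fin n))}
  {G : EuclideanSpace ℝ (Fin n) → Matrix (Fin n) (Fin n) ℝ}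

lemma contDiffOn_det (hG : ∀ i j, ContDiffOn ℝ ∞ (fun y => G y i j) U) :
    ContDiffOn ℝ ∞ (fun y => (G y).det) U := by
  simp only [Matrix.det_apply']
  exact ContDiffOn.sum fun σ _ => contDiffOn_const.mul (contDiffOn_prod fun i _ => hG _ _)

lemma contDiffOn_inv_apply (hG : ∀ i j, ContDiffOn ℝ ∞ (fun y => G y i j) U)
    (hdet : ∀ y ∈ U, (G y).det ≠ 0) (i j : Fin n) :
    ContDiffOn ℝ ∞ (fun y => (G y)⁻¹ i j) U := by
  simp only [Matrix.inv_def, Matrix.smul_apply, smul_eq_mul, Ring.inverse_eq_inv',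
    Matrix.adjugate_apply]
  refine ((contDiffOn_det hG).inv hdet).mul (contDiffOn_det fun a b => ?_)
  -- An adjugate entry is the determinant of G with row j replaced by a basis vector, so its entries
  -- are constants or entries of G.
  by_cases h : a = j
  · simpa [h] using contDiffOn_const
  · simpa [h] using hG a b

/-- The components on `U` of a smooth nondegenerate metric. -/
structure IsCoordMetric (U : Set (EuclideanSpace ℝ (Fin n)))
    (G : EuclideanSpace ℝ (Fin n) → Matrix (Fin n) (Fin n) ℝ) : Prop where
  isOpen : IsOpen U
  smooth : ∀ i j, ContDiffOn ℝ ∞ (fun y => G y i j) U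
  symm : ∀ y ∈ U, ∀ i j, G y i j = G y j i
  det_ne_zero : ∀ y ∈ U, (G y).det ≠ 0

namespace IsCoordMetric

open CoordTensor DiffMetric

/-- The metric over the algebra of smooth functions on `U`. -/
def diffMetric (h : IsCoordMetric U G) : DiffMetric (Fin n) (smoothFun U) where
  d := smoothPd h.isOpen
  d_comm i j f := by
    ext ⟨y, hy⟩
    have hr : Restricts (Function.extend Subtype.val f.1 0) f := fun y hy =>
      (extend_val_apply _ hy).symm
    rw [((hr.pd h.isOpen j).pd h.isOpen i) y hy, ((hr.pd h.isOpen i).pd h.isOpen j) y hy]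
    exact pd_comm h.isOpen f.2 i j hy
  g i j := restrictSmooth (h.smooth i j)
  gi i j := restrictSmooth (contDiffOn_inv_apply h.smooth h.det_ne_zero i j)
  symm i j := (Restricts.eq_iff (restricts_restrictSmooth _) (restricts_restrictSmooth _)).2
    fun y hy => h.symm y hy i j
  g_mul_gi := by
    ext i k ⟨y, hy⟩
    have h1 : G y * (G y)⁻¹ = 1 := Matrix.mul_nonsing_inv _ (h.det_ne_zero y hy).isUnit
    have h2 := congrFun (congrFun h1 i) k
    rw [Matrix.mul_apply, Matrix.one_apply] at h2
    rw [Matrix.mul_apply, Matrix.one_apply]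
    refine ((Restricts.sum Finset.univ fun j =>
      (restricts_restrictSmooth (h.smooth i j)).mul (restricts_restrictSmooth
        (contDiffOn_inv_apply h.smooth h.det_ne_zero j k))) y hy).trans (h2.trans ?_)
    split_ifs <;> rfl

variable (h : IsCoordMetric U G)

lemma restricts_g (i j : Fin n) : Restricts (fun y => G y i j) (h.diffMetric.g i j) :=
  restricts_restrictSmooth (h.smooth i j)

lemma restricts_gi (i j : Fin n) : Restricts (fun y => (G y)⁻¹ i j) (h.diffMetric.gi i j) :=
  restricts_restrictSmooth (contDiffOn_inv_apply h.smooth h.det_ne_zero i j)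

lemma restricts_d {F : EuclideanSpace ℝ (Fin n) → ℝ} {f : smoothFun U} (hF : Restricts F f)
    (i : Fin n) : Restricts (pd i F) (h.diffMetric.d i f) :=
  hF.pd h.isOpen i

lemma restricts_chr (k i j : Fin n) : Restricts (christoffel G k i j) (h.diffMetric.chr k i j) :=
  (Restricts.const _).mul <| .sum _ fun l => (h.restricts_gi k l).mul <|
    ((h.restricts_d (h.restricts_g j l) i).add (h.restricts_d (h.restricts_g i l) j)).sub
      (h.restricts_d (h.restricts_g i j) l)

lemma restricts_rup (a b c d : Fin n) :
    Restricts (riemannUp G a b c d) (h.diffMetric.rup a b c d) :=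
  ((h.restricts_d (h.restricts_chr a d b) c).sub (h.restricts_d (h.restricts_chr a c b) d)).add <|
    .sum _ fun e => ((h.restricts_chr a c e).mul (h.restricts_chr e d b)).sub
      ((h.restricts_chr a d e).mul (h.restricts_chr e c b))

lemma restricts_riem (a b c d : Fin n) :
    Restricts (riemann G a b c d) (h.diffMetric.riem a b c d) :=
  .sum _ fun e => (h.restricts_g a e).mul (h.restricts_rup e b c d)

lemma restricts_ric (b d : Fin n) : Restricts (ricci G b d) (h.diffMetric.ric b d) :=
  .sum _ fun a => h.restricts_rup a b a d

lemma restricts_tr {F : Fin n → Fin n → EuclideanSpace ℝ (Fin n) → ℝ}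
    {f : Fin n → Fin n → smoothFun U} (hF : ∀ i j, Restricts (F i j) (f i j)) :
    Restricts (fun y => ∑ i, ∑ j, (G y)⁻¹ i j * F i j y) (h.diffMetric.tr f) :=
  .sum _ fun i => .sum _ fun j => (h.restricts_gi i j).mul (hF i j)

lemma restricts_scal : Restricts (scalarCurv G) h.diffMetric.scal :=
  h.restricts_tr h.restricts_ric

lemma restricts_wey (j k l m : Fin n) :
    Restricts (weyl G j k l m) (h.diffMetric.wey j k l m) := by
  have hg := h.restricts_g
  have hr := h.restricts_ric
  have key := ((h.restricts_riem j k l m).sub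
    ((Restricts.const (U := U) (1 / ((Fintype.card (Fin n) : ℝ) - 2))).mul
      (((((hg j l).mul (hr k m)).sub ((hg j m).mul (hr k l))).add ((hg k m).mul (hr j l))).sub
        ((hg k l).mul (hr j m))))).add
    (((Restricts.const (U := U) (1 / (((Fintype.card (Fin n) : ℝ) - 1) *
      ((Fintype.card (Fin n) : ℝ) - 2)))).mul h.restricts_scal).mul
      (((hg j l).mul (hg k m)).sub ((hg j m).mul (hg k l))))
  intro y hy
  rw [DiffMetric.wey, weylCoeff, weylCoeff', key y hy, weyl, Fintype.card_fin]
  ring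

lemma restricts_con {V F : Fin n → EuclideanSpace ℝ (Fin n) → ℝ} {v f : Fin n → smoothFun U}
    (hV : ∀ i, Restricts (V i) (v i)) (hF : ∀ i, Restricts (F i) (f i)) :
    Restricts (fun y => ∑ i, V i y * F i y) (con v f) :=
  .sum _ fun i => (hV i).mul (hF i)

lemma restricts_low {V : Fin n → EuclideanSpace ℝ (Fin n) → ℝ} {v : Fin n → smoothFun U}
    (hV : ∀ i, Restricts (V i) (v i)) (j : Fin n) :
    Restricts (lower G V j) (h.diffMetric.low v j) :=
  .sum _ fun k => (h.restricts_g j k).mul (hV k)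

lemma restricts_weylContr {V : Fin n → EuclideanSpace ℝ (Fin n) → ℝ} {v : Fin n → smoothFun U}
    (hV : ∀ i, Restricts (V i) (v i)) (j k l : Fin n) :
    Restricts (weylContr G V j k l) (con v (h.diffMetric.wey j k l)) :=
  restricts_con hV (h.restricts_wey j k l)

lemma restricts_nab₁ {F : Fin n → EuclideanSpace ℝ (Fin n) → ℝ} {f : Fin n → smoothFun U}
    (hF : ∀ i, Restricts (F i) (f i)) (p j : Fin n) :
    Restricts (covDeriv₁ G F p j) (h.diffMetric.nab₁ f p j) :=
  (h.restricts_d (hF j) p).sub <| .sum _ fun a => (h.restricts_chr a p j).mul (hF a)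

lemma restricts_nab₃ {F : Fin n → Fin n → Fin n → EuclideanSpace ℝ (Fin n) → ℝ}
    {f : Fin n → Fin n → Fin n → smoothFun U} (hF : ∀ j k l, Restricts (F j k l) (f j k l))
    (p j k l : Fin n) : Restricts (covDeriv₃ G F p j k l) (h.diffMetric.nab₃ f p j k l) :=
  (((h.restricts_d (hF j k l) p).sub
    (.sum _ fun a => (h.restricts_chr a p j).mul (hF a k l))).sub
    (.sum _ fun a => (h.restricts_chr a p k).mul (hF j a l))).sub
    (.sum _ fun a => (h.restricts_chr a p l).mul (hF j k a))

lemma restricts_nab₄ {F : Fin n → Fin n → Fin n → Fin n → EuclideanSpace ℝ (Fin n) → ℝ}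
    {f : Fin n → Fin n → Fin n → Fin n → smoothFun U}
    (hF : ∀ j k l m, Restricts (F j k l m) (f j k l m)) (p j k l m : Fin n) :
    Restricts (covDeriv₄ G F p j k l m) (h.diffMetric.nab₄ f p j k l m) :=
  ((((h.restricts_d (hF j k l m) p).sub
    (.sum _ fun a => (h.restricts_chr a p j).mul (hF a k l m))).sub
    (.sum _ fun a => (h.restricts_chr a p k).mul (hF j a l m))).sub
    (.sum _ fun a => (h.restricts_chr a p l).mul (hF j k a m))).sub
    (.sum _ fun a => (h.restricts_chr a p m).mul (hF j k l a))

lemma restricts_divWey (j k l : Fin n) :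
    Restricts (divWeyl G j k l) (h.diffMetric.divWey j k l) :=
  h.restricts_tr fun m p => h.restricts_nab₄ h.restricts_wey p j k l m

section Torse

variable {V : Fin n → EuclideanSpace ℝ (Fin n) → ℝ} {ψ : EuclideanSpace ℝ (Fin n) → ℝ}

lemma isTorse (hV : ∀ i, ContDiffOn ℝ ∞ (V i) U) (hψ : ContDiffOn ℝ ∞ ψ U)
    (hunit : ∀ y ∈ U, ∑ i, V i y * lower G V i y = -1)
    (htorse : ∀ y ∈ U, ∀ i j, covDeriv₁ G (lower G V) i j y
      = ψ y * (G y i j + lower G V i y * lower G V j y)) :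
    h.diffMetric.IsTorse (fun i => restrictSmooth (hV i)) (restrictSmooth hψ) := by
  have hv := fun i => restricts_restrictSmooth (hV i)
  have hp := restricts_restrictSmooth hψ
  have hl := h.restricts_low hv
  constructor
  · ext ⟨y, hy⟩
    exact (restricts_con hv hl y hy).trans (hunit y hy)
  · intro i j
    exact ((h.restricts_nab₁ hl i j).eq_iff
      (hp.mul ((h.restricts_g i j).add ((hl i).mul (hl j))))).2 fun y hy => htorse y hy i j

/-- The Weyl tensor is divergence-free if its contraction with a torse-forming unit time-like
vector field vanishes. -/
lemma divWeyl_eq_zero (h : IsCoordMetric U G) (hn : 3 ≤ n) (hV : ∀ i, ContDiffOn ℝ ∞ (V i) U) (hψ : ContDiffOn ℝ ∞ ψ U)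
    (hunit : ∀ y ∈ U, ∑ i, V i y * lower G V i y = -1)
    (htorse : ∀ y ∈ U, ∀ i j, covDeriv₁ G (lower G V) i j y
      = ψ y * (G y i j + lower G V i y * lower G V j y))
    (hX : ∀ y ∈ U, ∀ j k l, weylContr G V j k l y = 0) :
    ∀ y ∈ U, ∀ j k l, divWeyl G j k l y = 0 := by
  have ht := h.isTorse hV hψ hunit htorse
  have hv := fun i => restricts_restrictSmooth (hV i)
  intro y hy j k l
  rw [← h.restricts_divWey j k l y hy, ht.divWey_eq_zero (by simpa using hn)]
  · rfl
  · intro j k l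
    ext ⟨z, hz⟩
    rw [h.restricts_weylContr hv j k l z hz, hX z hz]
    rfl

/-- The derivative, along a torse-forming unit time-like vector field, of the contraction of a
divergence-free Weyl tensor with that field. -/
lemma sum_covDeriv₃_weylContr (h : IsCoordMetric U G) (hn : 3 ≤ n)
    (hV : ∀ i, ContDiffOn ℝ ∞ (V i) U)
    (hψ : ContDiffOn ℝ ∞ ψ U)
    (hunit : ∀ y ∈ U, ∑ i, V i y * lower G V i y = -1)
    (htorse : ∀ y ∈ U, ∀ i j, covDeriv₁ G (lower G V) i j y
      = ψ y * (G y i j + lower G V i y * lower G V j y))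
    (hD : ∀ y ∈ U, ∀ j k l, divWeyl G j k l y = 0) :
    ∀ y ∈ U, ∀ j k l, ∑ p, V p y * covDeriv₃ G (weylContr G V) p j k l y
      = -(ψ y * ((n : ℝ) - 1)) * weylContr G V j k l y := by
  have ht := h.isTorse hV hψ hunit htorse
  have hv := fun i => restricts_restrictSmooth (hV i)
  have hX := h.restricts_weylContr hv
  intro y hy j k l
  have hD' : ∀ j k l, h.diffMetric.divWey j k l = 0 := fun j k l => by
    ext ⟨z, hz⟩
    rw [h.restricts_divWey j k l z hz, hD z hz]
    rfl
  have hc : Restricts (fun _ => (n : ℝ) - 1)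
      (((Fintype.card (Fin n) : ℕ) : smoothFun U) - 1) := fun z hz => by
    rw [Fintype.card_fin]; rfl
  exact ((restricts_con hv fun p => h.restricts_nab₃ hX p j k l).eq_iff
    (((restricts_restrictSmooth hψ).mul hc).neg.mul (hX j k l))).1
      (ht.nab_con_wey (by simpa using hn) hD' j k l) y hy

end Torse

end IsCoordMetric

end CoordMetric

/-! ### Components in a chart of the manifold -/

section ManifoldCharts

set_option linter.unusedSectionVars false

variable {n : ℕ} {M : Type*} [TopologicalSpace M]
  [ChartedSpace (EuclideanSpace ℝ (Fin n)) M] [IsManifold (𝓡 n) ∞ M]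
  {e : OpenPartialHomeomorph M (EuclideanSpace ℝ (Fin n))}

lemma mdifferentiable_of_mem_maximalAtlas (he : e ∈ IsManifold.maximalAtlas (𝓡 n) ∞ M) :
    e.MDifferentiable (𝓡 n) (𝓡 n) :=
  ⟨(contMDiffOn_of_mem_maximalAtlas he).mdifferentiableOn (by simp),
    (contMDiffOn_symm_of_mem_maximalAtlas he).mdifferentiableOn (by simp)⟩

lemma contMDiffOn_coordVec (he : e ∈ IsManifold.maximalAtlas (𝓡 n) ∞ M) (i : Fin n) :
    ContMDiffOn (𝓡 n) (𝓡 n).tangent ∞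
      (fun y ↦ (⟨e.symm y, coordVec e i y⟩ : TangentBundle (𝓡 n) M)) e.target := by
  have h1 : ContMDiffOn (𝓡 n) (𝓡 n).tangent ∞ (fun y ↦
      (⟨y, EuclideanSpace.single i (1 : ℝ)⟩ : TangentBundle (𝓡 n) (EuclideanSpace ℝ (Fin n))))
      e.target :=
    contMDiffOn_vectorSpace_iff_contDiffOn.2 contDiffOn_const
  have h2 := (contMDiffOn_symm_of_mem_maximalAtlas he).contMDiffOn_tangentMapWithin (m := ∞)
    (by norm_num) e.open_target.uniqueMDiffOn
  refine (h2.comp h1 fun y hy => hy).congr fun y hy => ?_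
  simp only [Function.comp_apply, tangentMapWithin, coordVec]
  rw [mfderivWithin_of_isOpen e.open_target hy]

lemma contDiffOn_comp (g : LorentzMetric n M) (he : e ∈ IsManifold.maximalAtlas (𝓡 n) ∞ M)
    (i j : Fin n) : ContDiffOn ℝ ∞ (fun y => g.comp e y i j) e.target := by
  -- The component is viewed as a section of the trivial line bundle, so that smoothness of g as a
  -- bundle section applies to the smooth coordinate fields.
  have h : ContMDiffOn (𝓡 n) ((𝓡 n).prod 𝓘(ℝ)) ∞
      (fun y ↦ Bundle.TotalSpace.mk' ℝ (E := Bundle.Trivial M ℝ) (e.symm y)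
        (g.val (e.symm y) (coordVec e i y) (coordVec e j y))) e.target := by
    apply ContMDiffOn.clm_bundle_apply₂ (F₁ := EuclideanSpace ℝ (Fin n))
      (F₂ := EuclideanSpace ℝ (Fin n))
    · exact g.contMDiff.comp_contMDiffOn (contMDiffOn_symm_of_mem_maximalAtlas he)
    · exact contMDiffOn_coordVec he i
    · exact contMDiffOn_coordVec he j
  intro y hy
  have := h y hy
  rw [Bundle.contMDiffWithinAt_totalSpace] at this
  exact this.2.contDiffWithinAt

lemma contDiffOn_vecComp {u : (x : M) → TangentSpace (𝓡 n) x}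
    (hu : ContMDiff (𝓡 n) (𝓡 n).tangent ∞ (fun x ↦ (⟨x, u x⟩ : TangentBundle (𝓡 n) M)))
    (he : e ∈ IsManifold.maximalAtlas (𝓡 n) ∞ M) (i : Fin n) :
    ContDiffOn ℝ ∞ (vecComp e u i) e.target := by
  have h1 := (contMDiffOn_of_mem_maximalAtlas he).contMDiffOn_tangentMapWithin (m := ∞)
    (by norm_num) e.open_source.uniqueMDiffOn
  have h2 := h1.comp (hu.comp_contMDiffOn (contMDiffOn_symm_of_mem_maximalAtlas he))
    fun y hy => e.map_target hy
  have h3 : ContMDiffOn (𝓡 n) (𝓡 n).tangent ∞ (fun y ↦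
      (⟨y, mfderiv (𝓡 n) (𝓡 n) e (e.symm y) (u (e.symm y))⟩ :
        TangentBundle (𝓡 n) (EuclideanSpace ℝ (Fin n)))) e.target := by
    refine h2.congr fun y hy => ?_
    simp only [Function.comp_apply, tangentMapWithin]
    rw [mfderivWithin_of_isOpen e.open_source (e.map_target hy), e.right_inv hy]
    rfl
  have h4 := contMDiffOn_vectorSpace_iff_contDiffOn.1 h3
  exact (EuclideanSpace.proj (𝕜 := ℝ) i).contDiff.comp_contDiffOn h4

lemma sum_smul_apply_single {F : Type*} [AddCommGroup F] [Module ℝ F] [TopologicalSpace F]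
    (L : EuclideanSpace ℝ (Fin n) →L[ℝ] F) (x : EuclideanSpace ℝ (Fin n)) :
    ∑ i, x i • L (EuclideanSpace.single i (1 : ℝ)) = L x := by
  have hx : x = ∑ i, x i • EuclideanSpace.single i (1 : ℝ) := by
    ext j; simp [Finset.sum_apply, Pi.single_apply]
  conv_rhs => rw [hx]
  simp only [map_sum, map_smul]

lemma sum_smul_coordVec_eq_mfderiv (e : OpenPartialHomeomorph M (EuclideanSpace ℝ (Fin n)))
    (y x : EuclideanSpace ℝ (Fin n)) :
    ∑ i, x i • coordVec e i y = mfderiv (𝓡 n) (𝓡 n) e.symm y x :=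
  sum_smul_apply_single (F := TangentSpace (𝓡 n) (e.symm y)) (mfderiv (𝓡 n) (𝓡 n) e.symm y) x

/-- Every tangent vector is the combination of the coordinate vectors with its components. -/
lemma sum_smul_coordVec (he : e ∈ IsManifold.maximalAtlas (𝓡 n) ∞ M)
    {y : EuclideanSpace ℝ (Fin n)} (hy : y ∈ e.target) (w : TangentSpace (𝓡 n) (e.symm y)) :
    ∑ i, (show EuclideanSpace ℝ (Fin n) from mfderiv (𝓡 n) (𝓡 n) e (e.symm y) w) i
      • coordVec e i y = w := by
  rw [sum_smul_coordVec_eq_mfderiv]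
  have h := (mdifferentiable_of_mem_maximalAtlas he).symm_comp_deriv (e.map_target hy)
  rw [e.right_inv hy] at h
  exact congrArg (fun L => L w) h

lemma sum_comp_mul (g : LorentzMetric n M) (y : EuclideanSpace ℝ (Fin n)) (a b : Fin n → ℝ) :
    g.val (e.symm y) (∑ i, a i • coordVec e i y) (∑ j, b j • coordVec e j y)
      = ∑ i, ∑ j, a i * (g.comp e y i j * b j) := by
  simp only [map_sum, map_smul, sum_apply, smul_apply,
    smul_eq_mul, LorentzMetric.comp, Matrix.of_apply, Finset.mul_sum]
  rw [Finset.sum_comm]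
  exact Finset.sum_congr rfl fun _ _ => Finset.sum_congr rfl fun _ _ => by ring

/-- A kernel vector of the matrix gives a tangent vector x orthogonal to everything. Being
orthogonal to the time-like vector, a nonzero x would have g(x,x) > 0, whereas g(x,x) = 0. So x = 0,
and the differential of the inverse chart is injective. -/
lemma det_comp_ne_zero (g : LorentzMetric n M) (he : e ∈ IsManifold.maximalAtlas (𝓡 n) ∞ M)
    {y : EuclideanSpace ℝ (Fin n)} (hy : y ∈ e.target) : (g.comp e y).det ≠ 0 := by
  intro hdet
  obtain ⟨c, hc, hGc⟩ := Matrix.exists_mulVec_eq_zero_iff.2 hdet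
  set x : TangentSpace (𝓡 n) (e.symm y) := ∑ j, c j • coordVec e j y with hx
  have horth : ∀ w, g.val (e.symm y) w x = 0 := by
    intro w
    rw [← sum_smul_coordVec he hy w, hx, sum_comp_mul]
    refine Finset.sum_eq_zero fun i _ => ?_
    rw [← Finset.mul_sum]
    have := congrFun hGc i
    simp only [Matrix.mulVec, dotProduct, Pi.zero_apply] at this
    rw [this, mul_zero]
  obtain ⟨v, -, hv⟩ := g.lorentzian (e.symm y)
  have hx0 : x = 0 := by
    by_contra hne
    exact (hv x (horth v) hne).ne' (horth x)
  have hLc : mfderiv (𝓡 n) (𝓡 n) e.symm y (WithLp.toLp 2 c : EuclideanSpace ℝ (Fin n)) = 0 := by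
    rw [← sum_smul_coordVec_eq_mfderiv]
    exact hx0
  have hid := congrArg (fun L => L (WithLp.toLp 2 c : EuclideanSpace ℝ (Fin n)))
    ((mdifferentiable_of_mem_maximalAtlas he).comp_symm_deriv hy)
  have hc0 : (WithLp.toLp 2 c : EuclideanSpace ℝ (Fin n)) = 0 := by
    refine hid.symm.trans ?_
    change mfderiv (𝓡 n) (𝓡 n) e (e.symm y) (mfderiv (𝓡 n) (𝓡 n) e.symm y _) = 0
    rw [hLc, map_zero]
  exact hc (congrArg WithLp.ofLp hc0)

lemma isCoordMetric_comp (g : LorentzMetric n M) (he : e ∈ IsManifold.maximalAtlas (𝓡 n) ∞ M) :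
    IsCoordMetric e.target (g.comp e) where
  isOpen := e.open_target
  smooth := contDiffOn_comp g he
  symm _ _ _ _ := g.symm _ _ _
  det_ne_zero _ hy := det_comp_ne_zero g he hy

lemma sum_vecComp_mul_lower (g : LorentzMetric n M)
    (he : e ∈ IsManifold.maximalAtlas (𝓡 n) ∞ M) (u : (x : M) → TangentSpace (𝓡 n) x)
    {y : EuclideanSpace ℝ (Fin n)} (hy : y ∈ e.target) :
    ∑ i, vecComp e u i y * CoordTensor.lower (g.comp e) (vecComp e u) i y
      = g.val (e.symm y) (u (e.symm y)) (u (e.symm y)) := by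
  have h := sum_comp_mul g (e := e) y (fun i => vecComp e u i y) (fun i => vecComp e u i y)
  have h2 : ∑ i, vecComp e u i y • coordVec e i y = u (e.symm y) := sum_smul_coordVec he hy _
  rw [h2] at h
  rw [h]
  simp only [CoordTensor.lower, Finset.mul_sum]

end ManifoldCharts

end

theorem theorem1 (n : ℕ) (hn : 3 < n) (M : Type*) [TopologicalSpace M]
    [ChartedSpace (EuclideanSpace ℝ (Fin n)) M] [IsManifold (𝓡 n) ∞ M]
    (g : LorentzMetric n M)
    (u : (x : M) → TangentSpace (𝓡 n) x)
    (hu : ContMDiff (𝓡 n) (𝓡 n).tangent ∞ (fun x ↦ (⟨x, u x⟩ : TangentBundle (𝓡 n) M)))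
    (hunit : ∀ x, g.val x (u x) (u x) = -1)
    (φ : M → ℝ) (hφ : ContMDiff (𝓡 n) 𝓘(ℝ, ℝ) ∞ φ)
    (htorse : ∀ e ∈ IsManifold.maximalAtlas (𝓡 n) ∞ M, ∀ y ∈ e.target, ∀ i j : Fin n,
      CoordTensor.covDeriv₁ (g.comp e) (CoordTensor.lower (g.comp e) (vecComp e u)) i j y =
        φ (e.symm y) * (g.comp e y i j +
          CoordTensor.lower (g.comp e) (vecComp e u) i y *
          CoordTensor.lower (g.comp e) (vecComp e u) j y)) :
    ((∀ e ∈ IsManifold.maximalAtlas (𝓡 n) ∞ M, ∀ y ∈ e.target, ∀ j k l : Fin n,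
        CoordTensor.weylContr (g.comp e) (vecComp e u) j k l y = 0) →
      (∀ e ∈ IsManifold.maximalAtlas (𝓡 n) ∞ M, ∀ y ∈ e.target, ∀ j k l : Fin n,
        CoordTensor.divWeyl (g.comp e) j k l y = 0)) ∧
    ((∀ e ∈ IsManifold.maximalAtlas (𝓡 n) ∞ M, ∀ y ∈ e.target, ∀ j k l : Fin n,
        CoordTensor.divWeyl (g.comp e) j k l y = 0) →
      (∀ e ∈ IsManifold.maximalAtlas (𝓡 n) ∞ M, ∀ y ∈ e.target, ∀ j k l : Fin n,
        ∑ p, vecComp e u p y *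
          CoordTensor.covDeriv₃ (g.comp e)
            (CoordTensor.weylContr (g.comp e) (vecComp e u)) p j k l y =
        -(φ (e.symm y) * ((n : ℝ) - 1)) *
          CoordTensor.weylContr (g.comp e) (vecComp e u) j k l y)) := by
  have hcoord := fun e he => isCoordMetric_comp (e := e) g he
  have hvec := fun e he i => contDiffOn_vecComp (e := e) hu he i
  have hφe : ∀ e ∈ IsManifold.maximalAtlas (𝓡 n) ∞ M,
      ContDiffOn ℝ ∞ (fun y => φ (e.symm y)) e.target := fun e he =>
    (hφ.comp_contMDiffOn (contMDiffOn_symm_of_mem_maximalAtlas he)).contDiffOn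
  have hunit' : ∀ e ∈ IsManifold.maximalAtlas (𝓡 n) ∞ M, ∀ y ∈ e.target,
      ∑ i, vecComp e u i y * CoordTensor.lower (g.comp e) (vecComp e u) i y = -1 :=
    fun e he y hy => by rw [sum_vecComp_mul_lower g he u hy, hunit]
  exact ⟨fun hX e he => (hcoord e he).divWeyl_eq_zero hn.le (hvec e he) (hφe e he)
      (hunit' e he) (htorse e he) (hX e he),
    fun hD e he => (hcoord e he).sum_covDeriv₃_weylContr hn.le (hvec e he) (hφe e he)
      (hunit' e he) (htorse e he) (hD e he)⟩
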